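/- Let $H^2$ be the Hardy space on the unit circle with basis $z^m$ ($m\ge 0$) and shift $Sf=zf$, and let $\mathbf C f(z)=\overline{f(\bar z)}$. Let $\Gamma_u$ be a Hankel operator on $H^2$, i.e. a bounded operator whose matrix in the basis $\{z^m\}$ is of the form $\{\gamma_{j+k}\}_{j,k\ge0}$, with symbol $u=\Gamma_u z^0=\sum_k\gamma_kz^k$ (as is well known, $u$ is the symbol of a bounded Hankel operator if and only if $u\in\mathrm{BMOA}(\mathbb T)$). Put $\widetilde\Gamma_u=\Gamma_uS$, $H_u=\Gamma_u\mathbf C$, $\widetilde H_u=H_uS$ (the latter two are anti-linear), $R_u=\overline{\operatorname{Ran}}\,H_u$, and let $H_u^{\mathrm e}$, $\widetilde H_u^{\mathrm e}$ be the restrictions of $H_u$, $\widetilde H_u$ to their invariant subspace $R_u$. For these operators $A$, $A^2$ is linear, self-adjoint and positive semi-definite, and $|A|:=(A^2)^{1/2}$. Assume that $u\in\mathrm{BMOA}_{\rm simp}$, i.e. that both $(H_u^{\mathrm e})^2$ and $(\widetilde H_u^{\mathrm e})^2$ have simple spectrum (possess a cyclic vector in $R_u$). Let $\rho$ and $\widetilde\rho$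 be the spectral measures of $|H_u^{\mathrm e}|$ and $|\widetilde H_u^{\mathrm e}|$ for the vector $u\in R_u$. Then $p\mapsto p(|H_u^{\mathrm e}|)u$ and $p\mapsto p(|\widetilde H_u^{\mathrm e}|)u$ ($p$ a polynomial) extend to unitary operators $U:L^2(\rho)\to R_u$ and $\widetilde U:L^2(\widetilde\rho)\to R_u$, and there are Borel functions $\Psi_u$, $\widetilde\Psi_u$, unimodular $\rho$-a.e. and $\widetilde\rho|_{(0,\infty)}$-a.e. respectively, such that $$[U^*H_u^{\mathrm e}U]f(s)=s\,\overline{\Psi_u(s)}\,\overline{f(s)}\quad(f\in L^2(\rho)),\qquad [\widetilde U^*\widetilde H_u^{\mathrm e}\widetilde U]f(s)=s\,\widetilde\Psi_u(s)\,\overline{f(s)}\quad(f\in L^2(\widetilde\rho)).$$ For any such $\Psi_u$, $\widetilde\Psi_u$ the following holds. (1) $\Gamma_u$ is self-adjoint if and only if $\Psi_u(s)\in\{1,-1\}$ for $\rho$-a.e. $s$ and $\widetilde\Psi_u(s)\in\{1,-1\}$ for $\widetilde\rho$-a.e. $s>0$. (2) If $\Gamma_u$ is self-adjoint, then $$\Gamma_u=\Psi_u(|\Gamma_u|)\,|\Gamma_u|,\qquad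 \widetilde\Gamma_u=\widetilde\Psi_u(|\widetilde\Gamma_u|)\,|\widetilde\Gamma_u|$$ are the polar decompositions of $\Gamma_u$ and $\widetilde\Gamma_u$, where one sets $\Psi_u(0)=0$ if $\operatorname{Ker}\Gamma_u\ne\{0\}$ and $\widetilde\Psi_u(0)=0$ if $\operatorname{Ker}\widetilde\Gamma_u\ne\{0\}$. Here $\varphi(|T|)$ is defined by the Borel functional calculus, and $T=\Phi|T|$ with $|T|=(T^*T)^{1/2}$ is the polar decomposition of $T$ when $\Phi$ is the partial isometry with initial subspace $\overline{\operatorname{Ran}}\,T^*$ and final subspace $\overline{\operatorname{Ran}}\,T$. -/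

import Mathlib

open MeasureTheory Polynomial
open scoped ENNReal InnerProductSpace ComplexConjugate

noncomputable section

namespace HankelSpec

/-! ### The Hardy space on the unit circle

The unit circle is `AddCircle (2 * π)`, the class of `t` being the point `z = exp (i t)`, with the
normalised Lebesgue measure. The function `z ^ n` is `fourier n`. -/

instance fact_two_pi_pos : Fact (0 < 2 * Real.pi) := ⟨Real.two_pi_pos⟩

/-- The unit circle. -/
abbrev Circ : Type := AddCircle (2 * Real.pi)

/-- The normalised Lebesgue measure on the unit circle. -/
abbrev haarC : Measure Circ := AddCircle.haarAddCircle

/-- `L²` of the unit circle. -/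
abbrev L2C : Type := Lp ℂ 2 haarC

lemma fourierCoeff_eq_inner (f : L2C) (n : ℤ) :
    fourierCoeff (f : Circ → ℂ) n = ⟪fourierLp 2 n, f⟫_ℂ := by
  rw [← fourierBasis_repr, HilbertBasis.repr_apply_apply, coe_fourierBasis]

/-- The Hardy space `H²`: the functions in `L²` of the unit circle whose Fourier coefficients of
negative index vanish. -/
def hardy : Submodule ℂ L2C where
  carrier := {f | ∀ n : ℤ, n < 0 → fourierCoeff (f : Circ → ℂ) n = 0}
  zero_mem' := by
    intro n _
    rw [fourierCoeff_eq_inner, inner_zero_right]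
  add_mem' := by
    intro f g hf hg n hn
    have h1 := hf n hn
    have h2 := hg n hn
    rw [fourierCoeff_eq_inner] at h1 h2 ⊢
    rw [inner_add_right, h1, h2, add_zero]
  smul_mem' := by
    intro c f hf n hn
    have h1 := hf n hn
    rw [fourierCoeff_eq_inner] at h1 ⊢
    rw [inner_smul_right, h1, mul_zero]

lemma mem_hardy {f : L2C} :
    f ∈ hardy ↔ ∀ n : ℤ, n < 0 → fourierCoeff (f : Circ → ℂ) n = 0 := Iff.rfl

lemma isClosed_hardy : IsClosed (hardy : Set L2C) := by
  have h : (hardy : Set L2C) = ⋂ n : ℤ, ⋂ _ : n < 0, {f : L2C | ⟪fourierLp 2 n, f⟫_ℂ = 0} := by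
    ext f
    simp only [SetLike.mem_coe, mem_hardy, fourierCoeff_eq_inner, Set.mem_iInter, Set.mem_ofPred_eq]
  rw [h]
  refine isClosed_iInter fun n => isClosed_iInter fun _ => ?_
  exact isClosed_eq (continuous_const.inner continuous_id) continuous_const

/-- The Hardy space as a Hilbert space. -/
def H2 : Type := hardy

instance normedAddCommGroup_H2 : NormedAddCommGroup H2 :=
  inferInstanceAs (NormedAddCommGroup hardy)

instance innerProductSpace_H2 : InnerProductSpace ℂ H2 :=
  inferInstanceAs (InnerProductSpace ℂ hardy)

instance completeSpace_H2 : CompleteSpace H2 := isClosed_hardy.completeSpace_coe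

/-- The inclusion of the Hardy space in `L²`. -/
def H2.incl : H2 →ₗᵢ[ℂ] L2C := hardy.subtypeₗᵢ

lemma H2.incl_mem (f : H2) : H2.incl f ∈ hardy := Subtype.property (p := (· ∈ hardy)) f

/-- A bounded linear or anti-linear map into `L²` with values in the Hardy space, as a map into the
Hardy space. -/
def H2.lift {σ : ℂ →+* ℂ} (T : H2 →SL[σ] L2C) (h : ∀ f, T f ∈ hardy) : H2 →SL[σ] H2 :=
  T.codRestrict hardy h

lemma fourierLp_mem_hardy (m : ℕ) : (fourierLp 2 (m : ℤ) : L2C) ∈ hardy := by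
  intro n hn
  rw [fourierCoeff_eq_inner]
  exact orthonormal_fourier.2 (by omega)

/-- The standard basis `z ^ m`, `m = 0, 1, 2, …`, of the Hardy space. -/
def zpw (m : ℕ) : H2 := ⟨fourierLp 2 (m : ℤ), fourierLp_mem_hardy m⟩

/-- Multiplication by `z` on `L²` of the unit circle. -/
def mulZ : L2C →L[ℂ] L2C :=
  (ContinuousLinearMap.mul ℂ ℂ).holderL haarC ∞ 2 2 (fourierLp ∞ 1)

lemma coeFn_mulZ (f : L2C) :
    (mulZ f : Circ → ℂ) =ᵐ[haarC] fun t => fourier 1 t * (f : Circ → ℂ) t := by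
  have h1 := (ContinuousLinearMap.mul ℂ ℂ).coeFn_holder (μ := haarC) (p := ∞) (q := 2) (r := 2)
    (fourierLp ∞ 1) f
  have h2 := coeFn_fourierLp (T := 2 * Real.pi) ∞ 1
  filter_upwards [h1, h2] with t ht1 ht2
  have h3 : (mulZ f : Circ → ℂ) t
    = (ContinuousLinearMap.mul ℂ ℂ) ((fourierLp ∞ 1 : Lp ℂ ∞ haarC) t) ((f : Circ → ℂ) t) := ht1
  rw [h3, ht2, ContinuousLinearMap.mul_apply']

lemma fourierCoeff_mulZ (f : L2C) (n : ℤ) :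
    fourierCoeff (mulZ f : Circ → ℂ) n = fourierCoeff (f : Circ → ℂ) (n - 1) := by
  unfold fourierCoeff
  refine integral_congr_ae ?_
  filter_upwards [coeFn_mulZ f] with t ht
  rw [ht, smul_eq_mul, smul_eq_mul, ← mul_assoc, ← fourier_add]
  congr 3
  ring

/-- The shift operator `S f = z f` on the Hardy space. -/
def shift : H2 →L[ℂ] H2 :=
  H2.lift (mulZ.comp H2.incl.toContinuousLinearMap) (by
    intro f n hn
    have h := H2.incl_mem f (n - 1) (by omega)
    rw [← fourierCoeff_mulZ] at h
    exact h)

/-- The anti-linear involution `f ↦ (z ↦ conj (f (conj z)))` of `L²` of the unit circle. -/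
def conjL2 : L2C →L⋆[ℂ] L2C :=
  (((starL ℂ : ℂ ≃L⋆[ℂ] ℂ) : ℂ →L⋆[ℂ] ℂ).compLpL 2 haarC).comp
    (Lp.compMeasurePreservingₗᵢ ℂ (fun t : Circ => -t)
      (Measure.measurePreserving_neg haarC)).toContinuousLinearMap

lemma coeFn_conjL2 (f : L2C) :
    (conjL2 f : Circ → ℂ) =ᵐ[haarC] fun t => conj ((f : Circ → ℂ) (-t)) := by
  have h1 := ((starL ℂ : ℂ ≃L⋆[ℂ] ℂ) : ℂ →L⋆[ℂ] ℂ).coeFn_compLpL (p := 2) (μ := haarC)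
    (Lp.compMeasurePreservingₗᵢ ℂ (fun t : Circ => -t) (Measure.measurePreserving_neg haarC) f)
  have h2 := Lp.coeFn_compMeasurePreserving f (Measure.measurePreserving_neg haarC)
  filter_upwards [h1, h2] with t ht1 ht2
  have h3 : (conjL2 f : Circ → ℂ) t = conj ((Lp.compMeasurePreserving (fun t : Circ => -t)
    (Measure.measurePreserving_neg haarC) f : Circ → ℂ) t) := ht1
  rw [h3]
  exact congrArg conj ht2

lemma fourierCoeff_conjL2 (f : L2C) (n : ℤ) :
    fourierCoeff (conjL2 f : Circ → ℂ) n = conj (fourierCoeff (f : Circ → ℂ) n) := by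
  unfold fourierCoeff
  rw [← integral_conj, ← integral_neg_eq_self]
  refine integral_congr_ae ?_
  have h := (Measure.measurePreserving_neg haarC).quasiMeasurePreserving.ae (coeFn_conjL2 f)
  filter_upwards [h] with t ht
  rw [ht, neg_neg, smul_eq_mul, smul_eq_mul, map_mul, fourier_neg, fourier_neg, Complex.conj_conj]
  congr 1
  simp [fourier_apply]

/-- The anti-linear involution `(C f) (z) = conj (f (conj z))` of the Hardy space. -/
def conjH : H2 →L⋆[ℂ] H2 :=
  H2.lift (conjL2.comp H2.incl.toContinuousLinearMap) (by
    intro f n hn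
    have h := H2.incl_mem f n hn
    have h' := fourierCoeff_conjL2 (H2.incl f) n
    rw [h, map_zero] at h'
    exact h')

lemma conjH_zpw (m : ℕ) : conjH (zpw m) = zpw m := by
  apply H2.incl.injective
  apply Lp.ext
  have h0 := coeFn_fourierLp (T := 2 * Real.pi) 2 (m : ℤ)
  have h1 := (Measure.measurePreserving_neg haarC).quasiMeasurePreserving.ae h0
  filter_upwards [h0, h1, coeFn_conjL2 (fourierLp 2 (m : ℤ))] with t ht0 ht1 ht2
  have h3 : (H2.incl (conjH (zpw m)) : Circ → ℂ) t = conj ((fourierLp 2 (m : ℤ) : L2C) (-t)) := ht2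
  have h4 : (H2.incl (zpw m) : Circ → ℂ) t = (fourierLp 2 (m : ℤ) : L2C) t := rfl
  rw [h3, h4, ht0, ht1, ← fourier_neg]
  simp [fourier_apply]

/-! ### Hankel operators -/

/-- A Hankel operator: a bounded operator on the Hardy space whose matrix in the basis `z ^ m` has
entries which depend on the sum of the two indices only. The symbols of these operators are exactly
the functions in `BMOA`. -/
def IsHankel (Γ : H2 →L[ℂ] H2) : Prop :=
  ∃ γ : ℕ → ℂ, ∀ j k : ℕ, ⟪zpw j, Γ (zpw k)⟫_ℂ = γ (j + k)

/-- The symbol `u = Γ z⁰ = ∑ γ_k z ^ k` of a Hankel operator `Γ = Γ_u`. -/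
def symbol (Γ : H2 →L[ℂ] H2) : H2 := Γ (zpw 0)

/-- The truncated operator `Γ S`. -/
def trunc (Γ : H2 →L[ℂ] H2) : H2 →L[ℂ] H2 := Γ.comp shift

/-- The anti-linear Hankel operator `H_u = Γ_u C`. -/
def antiH (Γ : H2 →L[ℂ] H2) : H2 →L⋆[ℂ] H2 := Γ.comp conjH

/-- The truncated anti-linear Hankel operator `H_u S`. -/
def antiHTrunc (Γ : H2 →L[ℂ] H2) : H2 →L⋆[ℂ] H2 := (antiH Γ).comp shift

/-- The closure of the range of `H_u`. -/
def essSpace (Γ : H2 →L[ℂ] H2) : Submodule ℂ H2 :=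
  (LinearMap.range (antiH Γ : H2 →ₛₗ[starRingEnd ℂ] H2)).topologicalClosure

instance completeSpace_essSpace (Γ : H2 →L[ℂ] H2) : CompleteSpace (essSpace Γ) :=
  (Submodule.isClosed_topologicalClosure _).completeSpace_coe

lemma antiH_mem_essSpace (Γ : H2 →L[ℂ] H2) (f : H2) : antiH Γ f ∈ essSpace Γ :=
  Submodule.le_topologicalClosure _ ⟨f, rfl⟩

/-- The essential part of `H_u`: its restriction to the closure of the range of `H_u`. -/
def essH (Γ : H2 →L[ℂ] H2) : essSpace Γ →L⋆[ℂ] essSpace Γ :=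
  ((antiH Γ).comp (essSpace Γ).subtypeL).codRestrict (essSpace Γ)
    (fun f => antiH_mem_essSpace Γ f)

/-- The essential part of the truncated operator: the restriction of `H_u S` to the closure of the
range of `H_u` (not of `H_u S`). -/
def essHTrunc (Γ : H2 →L[ℂ] H2) : essSpace Γ →L⋆[ℂ] essSpace Γ :=
  ((antiHTrunc Γ).comp (essSpace Γ).subtypeL).codRestrict (essSpace Γ)
    (fun f => antiH_mem_essSpace Γ (shift f))

/-- The symbol `u`, which is `H_u z⁰`, as a vector in the closure of the range of `H_u`. -/
def symbolEss (Γ : H2 →L[ℂ] H2) : essSpace Γ :=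
  ⟨symbol Γ, by
    have h := antiH_mem_essSpace Γ (zpw 0)
    have h' : antiH Γ (zpw 0) = symbol Γ := congrArg Γ (conjH_zpw 0)
    rwa [h'] at h⟩

/-! ### Spectral theory -/

section Hilbert

variable {X : Type*} [NormedAddCommGroup X] [InnerProductSpace ℂ X] [CompleteSpace X]

/-- A bounded (self-adjoint) operator has simple spectrum if it has a cyclic vector. -/
def HasSimpleSpectrum (A : X →L[ℂ] X) : Prop :=
  ∃ v : X, (Submodule.span ℂ (Set.range fun n : ℕ => (A ^ n) v)).topologicalClosure = ⊤

/-- `ρ` is the spectral measure of the bounded self-adjoint operator `A` for the vector `v`. -/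
def IsSpectralMeasure (A : X →L[ℂ] X) (v : X) (ρ : Measure ℝ) : Prop :=
  IsFiniteMeasure ρ ∧
    ∀ f : ℝ → ℝ, Continuous f → ⟪v, cfc f A v⟫_ℂ = ((∫ s, f s ∂ρ : ℝ) : ℂ)

/-- `T = φ(A)` in the sense of the Borel functional calculus of the bounded self-adjoint operator
`A`: the quadratic form of `T` at every vector `x` is the integral of `φ` with respect to the
spectral measure of `A` for `x`. This determines `T`. -/
def IsBorelFunctionOf (A : X →L[ℂ] X) (φ : ℝ → ℂ) (T : X →L[ℂ] X) : Prop :=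
  ∀ x : X, ∃ μ : Measure ℝ, IsSpectralMeasure A x μ ∧ Integrable φ μ ∧
    ⟪x, T x⟫_ℂ = ∫ s, φ s ∂μ

/-- The linear operator `A²`, for an anti-linear operator `A`. -/
def antiSq (A : X →L⋆[ℂ] X) : X →L[ℂ] X := A.comp A

/-- The modulus `|A| = (A²)^(1/2)` of an anti-linear operator `A` for which `A²` is positive. -/
def antiAbs (A : X →L⋆[ℂ] X) : X →L[ℂ] X := CFC.sqrt (antiSq A)

/-- The anti-linear operator `A`, with cyclic vector `v` for `|A|`, is modelled by the function `ψ`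
on `L²(ρ)`: `ρ` is the spectral measure of `|A|` for `v`, and for the unitary operator
`U : L²(ρ) → X` given by `U p = p(|A|) v` for polynomials `p`, one has
`(U⁻¹ A U f) (s) = s ψ(s) conj (f(s))` for all `f` in `L²(ρ)`. -/
def IsAntilinearModel (A : X →L⋆[ℂ] X) (v : X) (ρ : Measure ℝ) (ψ : ℝ → ℂ) : Prop :=
  IsSpectralMeasure (antiAbs A) v ρ ∧
    ∃ U : Lp ℂ 2 ρ ≃ₗᵢ[ℂ] X,
      (∀ p : ℂ[X], ∃ hp : MemLp (fun s : ℝ => p.eval (s : ℂ)) 2 ρ,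
        U (hp.toLp (fun s : ℝ => p.eval (s : ℂ))) = (aeval (antiAbs A) p) v) ∧
      ∀ f : Lp ℂ 2 ρ, (U.symm (A (U f)) : ℝ → ℂ) =ᵐ[ρ]
        fun s => (s : ℂ) * ψ s * conj ((f : ℝ → ℂ) s)

/-- The modulus `|T| = (T* T)^(1/2)` of a bounded linear operator. -/
def absOp (T : X →L[ℂ] X) : X →L[ℂ] X := CFC.abs T

/-- `T = Φ |T|` is the polar decomposition of `T`: here `Φ` is the partial isometry
with initial space the closure of the range of `T*` and final space the closure of the range of
`T`. -/
def IsPolarDecomposition (T Φ : X →L[ℂ] X) : Prop :=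
  T = Φ.comp (absOp T) ∧
    (∀ x ∈ (LinearMap.range (T.adjoint : X →ₗ[ℂ] X)).topologicalClosure, ‖Φ x‖ = ‖x‖) ∧
    (∀ x ∈ (LinearMap.range (T.adjoint : X →ₗ[ℂ] X)).topologicalClosureᗮ, Φ x = 0) ∧
    LinearMap.range (Φ : X →ₗ[ℂ] X) = (LinearMap.range (T : X →ₗ[ℂ] X)).topologicalClosure

open Classical in
/-- The function `ψ`, with its value at `0` set to `0` if `T` has a non-trivial kernel. -/
def zeroOnKer (T : X →L[ℂ] X) (ψ : ℝ → ℂ) : ℝ → ℂ :=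
  if LinearMap.ker (T : X →ₗ[ℂ] X) = ⊥ then ψ else Function.update ψ 0 0

end Hilbert

/-! ### The spectral data of a Hankel operator -/

/-- The simplicity assumption: the squares of the essential parts of `H_u` and of `H_u S` have
simple spectra. -/
def IsSimple (Γ : H2 →L[ℂ] H2) : Prop :=
  HasSimpleSpectrum (X := essSpace Γ) (antiSq (essH Γ)) ∧
    HasSimpleSpectrum (X := essSpace Γ) (antiSq (essHTrunc Γ))

/-- The measures `ρ`, `ρt` and the unimodular Borel functions `Ψ`, `Ψt` are the spectral measures
and the spectral functions of the Hankel operator `Γ = Γ_u`. The function `Ψt` matters on `(0, ∞)`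
only. -/
structure IsSpectralDatum (Γ : H2 →L[ℂ] H2) (ρ ρt : Measure ℝ) (Ψ Ψt : ℝ → ℂ) : Prop where
  measurable : Measurable Ψ
  measurable_trunc : Measurable Ψt
  unimodular : ∀ᵐ s ∂ρ, ‖Ψ s‖ = 1
  unimodular_trunc : ∀ᵐ s ∂(ρt.restrict (Set.Ioi 0)), ‖Ψt s‖ = 1
  model : IsAntilinearModel (X := essSpace Γ) (essH Γ) (symbolEss Γ) ρ (fun s => conj (Ψ s))
  model_trunc : IsAntilinearModel (X := essSpace Γ) (essHTrunc Γ) (symbolEss Γ) ρt Ψt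

end HankelSpec

end

open HankelSpec

/-! Write `H`, `H'` for `essH Γ`, `essHTrunc Γ`, `u` for the symbol and `C` for the conjugation
`conjH`. A Hankel matrix is symmetric, so `H` and `H'` satisfy `⟪A x, y⟫ = ⟪A y, x⟫`. Since `S* H =
H'` and `S S*` is the projection off `z ^ 0`, the two squares differ by a rank-one term: `H'² = H² -
⟪u, ·⟫ u` (`IsHankel.antiSq_essHTrunc`).

Existence. A self-adjoint `P` with `P u = 0` that commutes with one square commutes with both,
hence, by simplicity, with `H` and `H'` (`IsSymmAnti.comm_of_hasSimpleSpectrum`). It then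
annihilates the projections of all `z ^ n`, so `P = 0`. Thus `u` is cyclic for both squares
(`IsHankel.cyclic_essH`, `IsHankel.cyclic_essHTrunc`), and `IsSymmAnti.exists_model` turns each
operator into conjugation followed by multiplication by `s ψ(s)`.

Criterion. Complex conjugation in a model is transported to a conjugation of the essential space
which fixes `u` and commutes with the square; by cyclicity there is only one such map
(`conj_unique`). By the rank-one identity both models give the same conjugation `J`. A spectral
function is real exactly when `J` fixes the image of `u` under its operator. If both are real, `J`
commutes with `H` and `H'`, so it fixes the projections of all `z ^ n`, and the coefficients of `u`
are real. If `Γ` is self-adjoint, `C` itself has the defining properties of `J` and commutes with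
`H` and `H'`.

Polar decomposition. For self-adjoint `Γ` one has `J = C` on the essential space, so in `Γ = H C`
the conjugations cancel. Then `Γ` is multiplication by `s Ψ(s)` there and zero on the orthogonal
complement; likewise `trunc Γ`. The rest is the computation with multiplication operators in
`exists_polarDecomposition`. -/

noncomputable section

namespace HankelSpec

/-! ### Spectral measures of bounded self-adjoint operators. -/

section Spectral

variable {X : Type*} [NormedAddCommGroup X] [InnerProductSpace ℂ X] [CompleteSpace X]

/-- The factor `‖1‖` lets the bound cover the zero space, where `‖1‖ = 0`. -/
lemma abs_le_of_mem_spectrum {A : X →L[ℂ] X} {s : ℝ} (hs : s ∈ spectrum ℝ A) :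
    |s| ≤ ‖A‖ * ‖(1 : X →L[ℂ] X)‖ := by
  have := spectrum.norm_le_norm_mul_of_mem hs
  rwa [Real.norm_eq_abs] at this

/-- The quadratic form of a self-adjoint operator is real. -/
lemma re_inner_eq_of_isSelfAdjoint {T : X →L[ℂ] X} (hT : IsSelfAdjoint T) (v : X) :
    ((⟪v, T v⟫_ℂ).re : ℂ) = ⟪v, T v⟫_ℂ := by
  rw [← Complex.conj_eq_iff_re, inner_conj_symm]
  exact (ContinuousLinearMap.isSelfAdjoint_iff_isSymmetric.1 hT) v v

/-- Every vector has a spectral measure with respect to a bounded self-adjoint operator. -/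
theorem exists_isSpectralMeasure {A : X →L[ℂ] X} (hA : IsSelfAdjoint A) (v : X) :
    ∃ ρ : Measure ℝ, IsSpectralMeasure A v ρ := by
  have : CompactSpace (spectrum ℝ A) :=
    isCompact_iff_compactSpace.1 (spectrum.isCompact A)
  -- The quadratic form `f ↦ ⟪v, f(A) v⟫` is a positive functional on the continuous functions of
  -- the compact spectrum; Riesz–Markov–Kakutani represents it, and the measure is pushed forward to
  -- `ℝ`.
  let L : CompactlySupportedContinuousMap (spectrum ℝ A) ℝ →ₗ[ℝ] ℝ :=
    { toFun := fun f => (⟪v, cfcHom hA f.toContinuousMap v⟫_ℂ).re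
      map_add' := by
        intro f g
        have : (f + g).toContinuousMap = f.toContinuousMap + g.toContinuousMap := rfl
        rw [this, map_add, add_apply, inner_add_right, Complex.add_re]
      map_smul' := by
        intro c f
        have : (c • f).toContinuousMap = c • f.toContinuousMap := rfl
        rw [this, map_smul]
        change (⟪v, (c : ℂ) • (cfcHom hA f.toContinuousMap v)⟫_ℂ).re = c * _
        rw [inner_smul_right, Complex.re_ofReal_mul] }
  have hL : ∀ f, 0 ≤ f → 0 ≤ L f := by
    intro f hf
    have h : (0 : X →L[ℂ] X) ≤ cfcHom hA f.toContinuousMap :=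
      (cfcHom_nonneg_iff hA).2 fun x => hf x
    rw [ContinuousLinearMap.nonneg_iff_isPositive] at h
    exact h.re_inner_nonneg_right v
  let Λ := PositiveLinearMap.mk₀ L hL
  let ν := RealRMK.rieszMeasure Λ
  have : IsFiniteMeasure ν := by
    have : IsFiniteMeasureOnCompacts ν := by
      change IsFiniteMeasureOnCompacts (RealRMK.rieszMeasure Λ)
      infer_instance
    exact CompactSpace.isFiniteMeasure
  refine ⟨ν.map Subtype.val, inferInstance, fun f hf => ?_⟩
  rw [integral_map measurable_subtype_coe.aemeasurable hf.aestronglyMeasurable]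
  let g : CompactlySupportedContinuousMap (spectrum ℝ A) ℝ :=
    ⟨⟨fun x => f x, by fun_prop⟩, HasCompactSupport.of_compactSpace _⟩
  have h1 : ∫ x, f x ∂ν = L g := RealRMK.integral_rieszMeasure Λ g
  rw [h1]
  have h2 : cfc f A = cfcHom hA g.toContinuousMap := cfc_apply f A hA hf.continuousOn
  change _ = (((⟪v, cfcHom hA g.toContinuousMap v⟫_ℂ).re : ℝ) : ℂ)
  rw [← h2, re_inner_eq_of_isSelfAdjoint (cfc_predicate f A)]

/-- Here `f(A) = 0`, so the nonnegative `f` has integral zero. Boundedness supplies integrability,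
which is needed because the support of `ρ` is not yet under control. -/
lemma IsSpectralMeasure.ae_eq_zero {A : X →L[ℂ] X} {v : X} {ρ : Measure ℝ}
    (h : IsSpectralMeasure A v ρ) {f : ℝ → ℝ} (hf : Continuous f) (h0 : ∀ s, 0 ≤ f s)
    (h1 : ∀ s, f s ≤ 1) (hs : ∀ s ∈ spectrum ℝ A, f s = 0) : ∀ᵐ s ∂ρ, f s = 0 := by
  have := h.1
  have h2 := h.2 f hf
  have h3 : cfc f A = 0 := by
    rw [cfc_congr (g := fun _ => (0 : ℝ)) (fun s hs' => hs s hs')]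
    exact cfc_const_zero ℝ A
  rw [h3, zero_apply, inner_zero_right] at h2
  have h4 : ∫ s, f s ∂ρ = 0 := by exact_mod_cast h2.symm
  have hi : Integrable f ρ := by
    refine Integrable.of_bound hf.aestronglyMeasurable 1 (ae_of_all _ fun s => ?_)
    rw [Real.norm_eq_abs, abs_of_nonneg (h0 s)]
    exact h1 s
  exact (integral_eq_zero_iff_of_nonneg h0 hi).1 h4

lemma IsSpectralMeasure.ae_abs_le {A : X →L[ℂ] X} {v : X} {ρ : Measure ℝ}
    (h : IsSpectralMeasure A v ρ) : ∀ᵐ s ∂ρ, |s| ≤ ‖A‖ * ‖(1 : X →L[ℂ] X)‖ := by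
  set B := ‖A‖ * ‖(1 : X →L[ℂ] X)‖
  -- A bounded continuous function that is positive exactly outside `[-B, B]`.
  have := h.ae_eq_zero (f := fun s => min 1 (max 0 (|s| - B))) (by fun_prop)
    (fun s => by positivity) (fun s => min_le_left _ _)
    (fun s hs => by
      have : |s| - B ≤ 0 := sub_nonpos.2 (abs_le_of_mem_spectrum hs)
      simp [max_eq_left this])
  filter_upwards [this] with s hs
  by_contra hc
  have : 0 < min 1 (max 0 (|s| - B)) :=
    lt_min one_pos (lt_max_of_lt_right (by linarith [not_le.1 hc]))
  exact this.ne' hs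

lemma IsSpectralMeasure.ae_nonneg {A : X →L[ℂ] X} (hA : 0 ≤ A) {v : X} {ρ : Measure ℝ}
    (h : IsSpectralMeasure A v ρ) : ∀ᵐ s ∂ρ, 0 ≤ s := by
  have := h.ae_eq_zero (f := fun s => min 1 (max 0 (-s))) (by fun_prop)
    (fun s => by positivity) (fun s => min_le_left _ _)
    (fun s hs => by
      have : -s ≤ 0 := neg_nonpos.2 (spectrum_nonneg_of_nonneg hA hs)
      simp [max_eq_left this])
  filter_upwards [this] with s hs
  by_contra hc
  have : 0 < min 1 (max 0 (-s)) :=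
    lt_min one_pos (lt_max_of_lt_right (by linarith [not_le.1 hc]))
  exact this.ne' hs

lemma integrable_of_continuous_of_ae_abs_le {E : Type*} [NormedAddCommGroup E]
    {μ : Measure ℝ} [IsFiniteMeasure μ] {B : ℝ}
    (hμ : ∀ᵐ s ∂μ, |s| ≤ B) {f : ℝ → E} (hf : Continuous f) : Integrable f μ := by
  obtain ⟨C, hC⟩ := (isCompact_Icc (a := -B) (b := B)).exists_bound_of_continuousOn
    hf.continuousOn
  refine Integrable.of_bound (hf.aestronglyMeasurable) C ?_
  filter_upwards [hμ] with s hs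
  exact hC s (abs_le.1 hs)

lemma memLp_of_continuous_of_ae_abs_le {E : Type*} [NormedAddCommGroup E]
    {μ : Measure ℝ} [IsFiniteMeasure μ] {B : ℝ}
    (hμ : ∀ᵐ s ∂μ, |s| ≤ B) {f : ℝ → E} (hf : Continuous f) (p : ℝ≥0∞) : MemLp f p μ := by
  obtain ⟨C, hC⟩ := (isCompact_Icc (a := -B) (b := B)).exists_bound_of_continuousOn
    hf.continuousOn
  refine MemLp.of_bound (hf.aestronglyMeasurable) C ?_
  filter_upwards [hμ] with s hs
  exact hC s (abs_le.1 hs)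

/-- A compactly supported measure with the right moments is the spectral measure. -/
theorem isSpectralMeasure_of_moments {A : X →L[ℂ] X} (hA : IsSelfAdjoint A) {v : X}
    {μ : Measure ℝ} [IsFiniteMeasure μ] {B : ℝ} (hμ : ∀ᵐ s ∂μ, |s| ≤ B)
    (hm : ∀ n : ℕ, ⟪v, (A ^ n) v⟫_ℂ = ((∫ s, s ^ n ∂μ : ℝ) : ℂ)) :
    IsSpectralMeasure A v μ := by
  refine ⟨inferInstance, fun f hf => ?_⟩
  have hpoly : ∀ q : ℝ[X], ⟪v, cfc (fun s => q.eval s) A v⟫_ℂ = ((∫ s, q.eval s ∂μ : ℝ) : ℂ) := by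
    intro q
    rw [cfc_polynomial q A hA]
    induction q using Polynomial.induction_on' with
    | add p q hp hq =>
      rw [map_add, add_apply, inner_add_right, hp, hq]
      simp only [eval_add]
      rw [integral_add (integrable_of_continuous_of_ae_abs_le hμ (by fun_prop))
        (integrable_of_continuous_of_ae_abs_le hμ (by fun_prop)), Complex.ofReal_add]
    | monomial n c =>
      rw [aeval_monomial]
      have : (algebraMap ℝ (X →L[ℂ] X) c * A ^ n) v = (c : ℂ) • ((A ^ n) v) := by
        rw [← Algebra.smul_def]; rfl
      rw [this, inner_smul_right, hm]
      simp only [eval_monomial]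
      rw [integral_const_mul, Complex.ofReal_mul]
  -- The interval `[-B', B']` contains the spectrum and carries `μ`, so one polynomial approximates
  -- `f` for both sides; `c` collects the two error factors, with `+ 1` for positivity.
  set B' := max B (‖A‖ * ‖(1 : X →L[ℂ] X)‖)
  set c := ‖v‖ * ‖v‖ + μ.real Set.univ + 1
  have hc : 0 < c := by positivity
  refine eq_of_forall_dist_le fun ε hε => ?_
  obtain ⟨q, hq⟩ := exists_polynomial_near_of_continuousOn (-B') B' f hf.continuousOn (ε / c)
    (by positivity)
  have h1 : ‖cfc f A - cfc (fun s => q.eval s) A‖ ≤ ε / c := by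
    rw [← cfc_sub f (fun s => q.eval s) A hf.continuousOn (by fun_prop)]
    refine norm_cfc_le (by positivity) fun s hs => ?_
    have hs' := abs_le.1 ((abs_le_of_mem_spectrum hs).trans (le_max_right B _))
    rw [Real.norm_eq_abs, abs_sub_comm]
    exact (hq s hs').le
  have h2 : ‖⟪v, cfc f A v⟫_ℂ - ⟪v, cfc (fun s => q.eval s) A v⟫_ℂ‖ ≤ ε / c * (‖v‖ * ‖v‖) := by
    rw [← inner_sub_right, ← sub_apply]
    calc _ ≤ ‖v‖ * ‖(cfc f A - cfc (fun s => q.eval s) A) v‖ := norm_inner_le_norm _ _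
      _ ≤ ‖v‖ * (ε / c * ‖v‖) := by
        gcongr
        exact ContinuousLinearMap.le_of_opNorm_le _ h1 v
      _ = _ := by ring
  have h3 : ‖((∫ s, q.eval s ∂μ : ℝ) : ℂ) - ((∫ s, f s ∂μ : ℝ) : ℂ)‖ ≤ ε / c * μ.real Set.univ := by
    rw [← Complex.ofReal_sub, Complex.norm_real,
      ← integral_sub (integrable_of_continuous_of_ae_abs_le hμ (by fun_prop))
        (integrable_of_continuous_of_ae_abs_le hμ hf)]
    refine norm_integral_le_of_norm_le_const ?_
    filter_upwards [hμ] with s hs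
    exact (hq s (abs_le.1 (hs.trans (le_max_left _ _)))).le
  rw [dist_eq_norm]
  calc _ = ‖(⟪v, cfc f A v⟫_ℂ - ⟪v, cfc (fun s => q.eval s) A v⟫_ℂ)
        + (((∫ s, q.eval s ∂μ : ℝ) : ℂ) - ((∫ s, f s ∂μ : ℝ) : ℂ))‖ := by
          rw [hpoly]; congr 1; ring
    _ ≤ ε / c * (‖v‖ * ‖v‖) + ε / c * μ.real Set.univ := (norm_add_le _ _).trans (add_le_add h2 h3)
    _ ≤ ε / c * c := by
      rw [← mul_add]
      gcongr
      simp [c]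
    _ = ε := by field_simp

end Spectral

/-! ### Multiplication and conjugation on `L²(ρ)`. -/

section MultiplicationOperators

variable {ρ : Measure ℝ}

/-- Multiplication by an essentially bounded function on `L²(ρ)`. -/
def mulOp (g : ℝ → ℂ) (hg : MemLp g ∞ ρ) : Lp ℂ 2 ρ →L[ℂ] Lp ℂ 2 ρ :=
  (ContinuousLinearMap.mul ℂ ℂ).holderL ρ ∞ 2 2 (hg.toLp g)

lemma coeFn_mulOp (g : ℝ → ℂ) (hg : MemLp g ∞ ρ) (f : Lp ℂ 2 ρ) :
    (mulOp g hg f : ℝ → ℂ) =ᵐ[ρ] fun s => g s * (f : ℝ → ℂ) s := by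
  filter_upwards [(ContinuousLinearMap.mul ℂ ℂ).coeFn_holder (r := 2) (hg.toLp g) f,
    hg.coeFn_toLp] with s h1 h2
  have h3 : (mulOp g hg f : ℝ → ℂ) s
    = (ContinuousLinearMap.mul ℂ ℂ) ((hg.toLp g : ℝ → ℂ) s) ((f : ℝ → ℂ) s) := h1
  rw [h3, h2, ContinuousLinearMap.mul_apply']

/-- The product of two square integrable functions. -/
def mulL1 (g : Lp ℂ 2 ρ) : Lp ℂ 2 ρ →L[ℂ] Lp ℂ 1 ρ :=
  (ContinuousLinearMap.mul ℂ ℂ).holderL ρ 2 2 1 g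

lemma coeFn_mulL1 (g f : Lp ℂ 2 ρ) :
    (mulL1 g f : ℝ → ℂ) =ᵐ[ρ] fun s => (g : ℝ → ℂ) s * (f : ℝ → ℂ) s := by
  filter_upwards [(ContinuousLinearMap.mul ℂ ℂ).coeFn_holder (r := 1) g f] with s h1
  exact h1

/-- Complex conjugation on `L²(ρ)`. -/
def conjLp (ρ : Measure ℝ) : Lp ℂ 2 ρ →L⋆[ℂ] Lp ℂ 2 ρ :=
  ((starL ℂ : ℂ ≃L⋆[ℂ] ℂ) : ℂ →L⋆[ℂ] ℂ).compLpL 2 ρ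

lemma coeFn_conjLp (f : Lp ℂ 2 ρ) :
    (conjLp ρ f : ℝ → ℂ) =ᵐ[ρ] fun s => conj ((f : ℝ → ℂ) s) :=
  ((starL ℂ : ℂ ≃L⋆[ℂ] ℂ) : ℂ →L⋆[ℂ] ℂ).coeFn_compLpL f

lemma inner_conjLp (f g : Lp ℂ 2 ρ) : ⟪conjLp ρ f, conjLp ρ g⟫_ℂ = ⟪g, f⟫_ℂ := by
  rw [L2.inner_def, L2.inner_def]
  refine integral_congr_ae ?_
  filter_upwards [coeFn_conjLp f, coeFn_conjLp g] with s h1 h2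
  rw [h1, h2]
  simp [mul_comm]

end MultiplicationOperators

/-! ### Density of the polynomials in `L²(ρ)`. -/

section Polynomials

variable {ρ : Measure ℝ} [IsFiniteMeasure ρ] {B : ℝ}

lemma memLp_eval (hB : ∀ᵐ s ∂ρ, |s| ≤ B) (p : ℂ[X]) (r : ℝ≥0∞) :
    MemLp (fun s : ℝ => p.eval (s : ℂ)) r ρ :=
  memLp_of_continuous_of_ae_abs_le hB (by fun_prop) r

/-- The polynomials as elements of `L²(ρ)`, for a compactly supported measure `ρ`. -/
def polyLp (hB : ∀ᵐ s ∂ρ, |s| ≤ B) : ℂ[X] →ₗ[ℂ] Lp ℂ 2 ρ where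
  toFun p := (memLp_eval hB p 2).toLp _
  map_add' p q := by
    rw [← MemLp.toLp_add]
    congr 1
    ext s
    simp
  map_smul' c p := by
    rw [RingHom.id_apply, ← MemLp.toLp_const_smul]
    congr 1
    ext s
    simp

lemma coeFn_polyLp (hB : ∀ᵐ s ∂ρ, |s| ≤ B) (p : ℂ[X]) :
    (polyLp hB p : ℝ → ℂ) =ᵐ[ρ] fun s : ℝ => p.eval (s : ℂ) :=
  (memLp_eval hB p 2).coeFn_toLp

lemma exists_polynomial_near_complex (a b : ℝ) {f : ℝ → ℂ} (hf : Continuous f) {ε : ℝ}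
    (hε : 0 < ε) : ∃ p : ℂ[X], ∀ s ∈ Set.Icc a b, ‖f s - p.eval (s : ℂ)‖ ≤ ε := by
  obtain ⟨p, hp⟩ := exists_polynomial_near_of_continuousOn a b (fun s => (f s).re)
    (by fun_prop) (ε / 2) (by positivity)
  obtain ⟨q, hq⟩ := exists_polynomial_near_of_continuousOn a b (fun s => (f s).im)
    (by fun_prop) (ε / 2) (by positivity)
  refine ⟨p.map Complex.ofRealHom + C Complex.I * q.map Complex.ofRealHom, fun s hs => ?_⟩
  have h1 : ∀ r : ℝ[X], (r.map Complex.ofRealHom).eval (s : ℂ) = ((r.eval s : ℝ) : ℂ) :=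
    fun r => Polynomial.eval_map_apply (f := Complex.ofRealHom) s
  rw [eval_add, eval_mul, eval_C, h1, h1]
  have h2 : f s - ((p.eval s : ℝ) + Complex.I * (q.eval s : ℝ) : ℂ)
      = (((f s).re - p.eval s : ℝ) : ℂ) + Complex.I * (((f s).im - q.eval s : ℝ) : ℂ) := by
    conv_lhs => rw [← Complex.re_add_im (f s)]
    push_cast
    ring
  rw [h2]
  refine (norm_add_le _ _).trans ?_
  rw [norm_mul, Complex.norm_I, one_mul, Complex.norm_real, Complex.norm_real, Real.norm_eq_abs,
    Real.norm_eq_abs, abs_sub_comm, abs_sub_comm _ (q.eval s)]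
  linarith [hp s hs, hq s hs]

/-- The polynomials are dense in `L²(ρ)` for a compactly supported measure `ρ`. -/
theorem denseRange_polyLp (hB : ∀ᵐ s ∂ρ, |s| ≤ B) : DenseRange (polyLp hB) := by
  have h := BoundedContinuousFunction.toLp_denseRange (p := 2) ℂ ρ ℂ (by simp)
  refine dense_closure.1 (h.mono ?_)
  rintro _ ⟨g, rfl⟩
  rw [Metric.mem_closure_iff]
  intro ε hε
  set m : ℝ := (measureUnivNNReal ρ : ℝ) ^ (2 : ℝ≥0∞).toReal⁻¹
  have hm : 0 ≤ m := by positivity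
  obtain ⟨p, hp⟩ := exists_polynomial_near_complex (-B) B g.continuous
    (ε := ε / (m + 1)) (by positivity)
  refine ⟨polyLp hB p, ⟨p, rfl⟩, ?_⟩
  rw [dist_eq_norm]
  have h1 : ‖BoundedContinuousFunction.toLp 2 ρ ℂ g - polyLp hB p‖ ≤ m * (ε / (m + 1)) := by
    refine Lp.norm_le_of_ae_bound (by positivity) ?_
    filter_upwards [Lp.coeFn_sub (BoundedContinuousFunction.toLp 2 ρ ℂ g) (polyLp hB p),
      coeFn_polyLp hB p, BoundedContinuousFunction.coeFn_toLp (p := 2) ρ ℂ g, hB] with s h1 h2 h3 h4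
    rw [h1, Pi.sub_apply, h2, h3]
    exact hp s (abs_le.1 h4)
  refine h1.trans_lt ?_
  rw [← mul_div_assoc, div_lt_iff₀ (by positivity)]
  nlinarith

lemma inner_polyLp (hB : ∀ᵐ s ∂ρ, |s| ≤ B) (p q : ℂ[X]) :
    ⟪polyLp hB p, polyLp hB q⟫_ℂ = ∫ s : ℝ, conj (p.eval (s : ℂ)) * q.eval (s : ℂ) ∂ρ := by
  rw [L2.inner_def]
  refine integral_congr_ae ?_
  filter_upwards [coeFn_polyLp hB p, coeFn_polyLp hB q] with s h1 h2
  rw [h1, h2]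
  simp [mul_comm]

end Polynomials

/-! ### Functional models of symmetric anti-linear operators. -/

section Models

variable {X : Type*} [NormedAddCommGroup X] [InnerProductSpace ℂ X] [CompleteSpace X]

lemma IsSpectralMeasure.inner_pow {A : X →L[ℂ] X} (hA : IsSelfAdjoint A) {v : X} {ρ : Measure ℝ}
    (h : IsSpectralMeasure A v ρ) (n : ℕ) :
    ⟪v, (A ^ n) v⟫_ℂ = ((∫ s, s ^ n ∂ρ : ℝ) : ℂ) := by
  rw [← h.2 (fun s => s ^ n) (by fun_prop), cfc_pow_id A n hA]

/-- The map `p ↦ p(A) v`. -/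
def aevalVec (A : X →L[ℂ] X) (v : X) : ℂ[X] →ₗ[ℂ] X where
  toFun p := aeval A p v
  map_add' p q := by rw [map_add, add_apply]
  map_smul' c p := by rw [map_smul, smul_apply, RingHom.id_apply]

omit [CompleteSpace X] in
lemma aevalVec_apply (A : X →L[ℂ] X) (v : X) (p : ℂ[X]) : aevalVec A v p = aeval A p v := rfl

omit [CompleteSpace X] in
lemma aevalVec_monomial (A : X →L[ℂ] X) (v : X) (n : ℕ) (c : ℂ) :
    aevalVec A v (monomial n c) = c • (A ^ n) v := by
  rw [aevalVec_apply, aeval_monomial, ← Algebra.smul_def, smul_apply]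

lemma inner_pow_pow {A : X →L[ℂ] X} (hA : IsSelfAdjoint A) (v w : X) (m n : ℕ) :
    ⟪(A ^ m) v, (A ^ n) w⟫_ℂ = ⟪v, (A ^ (m + n)) w⟫_ℂ := by
  rw [pow_add]
  exact (ContinuousLinearMap.isSelfAdjoint_iff_isSymmetric.1 (hA.pow m)) v _

/-- By sesquilinearity this reduces to monomials, where it is the moment formula for `ρ`. It makes
`p ↦ p(A) v` isometric for the `L²(ρ)` norm. -/
lemma inner_aevalVec {A : X →L[ℂ] X} (hA : IsSelfAdjoint A) {v : X} {ρ : Measure ℝ}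
    [IsFiniteMeasure ρ] (h : IsSpectralMeasure A v ρ) {B : ℝ} (hB : ∀ᵐ s ∂ρ, |s| ≤ B) (p q : ℂ[X]) :
    ⟪aevalVec A v p, aevalVec A v q⟫_ℂ = ⟪polyLp hB p, polyLp hB q⟫_ℂ := by
  induction p using Polynomial.induction_on' with
  | add p₁ p₂ h₁ h₂ => rw [map_add, map_add, inner_add_left, inner_add_left, h₁, h₂]
  | monomial m c =>
    induction q using Polynomial.induction_on' with
    | add q₁ q₂ h₁ h₂ => rw [map_add, map_add, inner_add_right, inner_add_right, h₁, h₂]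
    | monomial n d =>
      rw [inner_polyLp, aevalVec_monomial, aevalVec_monomial, inner_smul_left, inner_smul_right,
        inner_pow_pow hA, h.inner_pow hA, ← integral_complex_ofReal, ← integral_const_mul,
        ← integral_const_mul]
      congr 1
      ext s
      simp only [eval_monomial, map_mul, map_pow, Complex.conj_ofReal, Complex.ofReal_pow]
      ring

omit [CompleteSpace X] in
lemma ext_of_cyclic {T : X →L[ℂ] X} {v : X}
    (hv : (Submodule.span ℂ (Set.range fun n : ℕ => (T ^ n) v)).topologicalClosure = ⊤)
    {Y : Type*} [NormedAddCommGroup Y] [NormedSpace ℂ Y] {σ : ℂ →+* ℂ} {F G : X →SL[σ] Y}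
    (h : ∀ n : ℕ, F ((T ^ n) v) = G ((T ^ n) v)) : F = G := by
  refine ContinuousLinearMap.ext_on (s := Set.range fun n : ℕ => (T ^ n) v) ?_ ?_
  · rwa [Submodule.dense_iff_topologicalClosure_eq_top]
  · rintro _ ⟨n, rfl⟩
    exact h n

/-- The antilinear analogue of symmetry. -/
def IsSymmAnti (A : X →L⋆[ℂ] X) : Prop := ∀ x y, ⟪A x, y⟫_ℂ = ⟪A y, x⟫_ℂ

omit [CompleteSpace X] in
lemma antiSq_apply (A : X →L⋆[ℂ] X) (x : X) : antiSq A x = A (A x) := rfl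

omit [CompleteSpace X] in
lemma IsSymmAnti.inner_antiSq {A : X →L⋆[ℂ] X} (hA : IsSymmAnti A) (x y : X) :
    ⟪antiSq A x, y⟫_ℂ = ⟪A y, A x⟫_ℂ := hA (A x) y

omit [CompleteSpace X] in
lemma IsSymmAnti.isPositive_antiSq {A : X →L⋆[ℂ] X} (hA : IsSymmAnti A) :
    (antiSq A).IsPositive := by
  refine ⟨fun x y => ?_, fun x => ?_⟩
  · change ⟪antiSq A x, y⟫_ℂ = ⟪x, antiSq A y⟫_ℂ
    rw [hA.inner_antiSq, ← inner_conj_symm x, hA.inner_antiSq, inner_conj_symm]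
  · change 0 ≤ (⟪antiSq A x, x⟫_ℂ).re
    rw [hA.inner_antiSq]
    exact inner_self_nonneg (𝕜 := ℂ)

lemma antiAbs_nonneg (A : X →L⋆[ℂ] X) : 0 ≤ antiAbs A := CFC.sqrt_nonneg _

lemma isSelfAdjoint_antiAbs (A : X →L⋆[ℂ] X) : IsSelfAdjoint (antiAbs A) :=
  IsSelfAdjoint.of_nonneg (antiAbs_nonneg A)

lemma IsSymmAnti.antiAbs_mul_self {A : X →L⋆[ℂ] X} (hA : IsSymmAnti A) :
    antiAbs A * antiAbs A = antiSq A :=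
  CFC.sqrt_mul_sqrt_self _
    ((ContinuousLinearMap.nonneg_iff_isPositive _).2 hA.isPositive_antiSq)

lemma IsSymmAnti.antiSq_pow {A : X →L⋆[ℂ] X} (hA : IsSymmAnti A) (n : ℕ) :
    antiSq A ^ n = antiAbs A ^ (2 * n) := by
  rw [pow_mul, pow_two, hA.antiAbs_mul_self]

omit [CompleteSpace X] in
lemma antiSq_pow_comm (A : X →L⋆[ℂ] X) (n : ℕ) (x : X) :
    A ((antiSq A ^ n) x) = (antiSq A ^ n) (A x) := by
  induction n generalizing x with
  | zero => rfl
  | succ n ih =>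
    rw [pow_succ]
    exact ih (antiSq A x)

/-- A symmetric antilinear operator with cyclic vector has a functional model. -/
theorem IsSymmAnti.exists_model {A : X →L⋆[ℂ] X} (hA : IsSymmAnti A) {v : X}
    (hv : (Submodule.span ℂ (Set.range fun n : ℕ => (antiSq A ^ n) v)).topologicalClosure = ⊤) :
    ∃ (ρ : Measure ℝ) (ψ : ℝ → ℂ), Measurable ψ ∧ (∀ s, ‖ψ s‖ = 1) ∧
      IsAntilinearModel A v ρ ψ := by
  set N := antiAbs A with hN
  have hNs : IsSelfAdjoint N := isSelfAdjoint_antiAbs A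
  obtain ⟨ρ, hρ⟩ := exists_isSpectralMeasure hNs v
  have := hρ.1
  have hB := hρ.ae_abs_le
  -- Cyclicity for `A²` already gives density with the even powers of `|A|`.
  have hdense : DenseRange (aevalVec N v) := by
    have h : Dense (Submodule.span ℂ (Set.range fun n : ℕ => (antiSq A ^ n) v) : Set X) := by
      rwa [Submodule.dense_iff_topologicalClosure_eq_top]
    refine h.mono ?_
    rw [← LinearMap.coe_range, SetLike.coe_subset_coe, Submodule.span_le]
    rintro _ ⟨n, rfl⟩
    refine ⟨monomial (2 * n) 1, ?_⟩
    rw [aevalVec_monomial, one_smul]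
    simp only [hA.antiSq_pow, hN]
  have hnorm : ∀ p, ‖aevalVec N v p‖ = ‖polyLp hB p‖ := by
    intro p
    rw [norm_eq_sqrt_re_inner (𝕜 := ℂ), norm_eq_sqrt_re_inner (𝕜 := ℂ), inner_aevalVec hNs hρ hB]
  let U : Lp ℂ 2 ρ ≃ₗᵢ[ℂ] X := (LinearEquiv.refl ℂ ℂ[X]).extendOfIsometry (polyLp hB)
    (aevalVec N v) (denseRange_polyLp hB) hdense hnorm
  have hU : ∀ p, U (polyLp hB p) = aevalVec N v p := fun p =>
    LinearEquiv.extendOfIsometry_eq (LinearEquiv.refl ℂ ℂ[X]) (polyLp hB)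
      (aevalVec N v) (denseRange_polyLp hB) hdense hnorm p
  have hUs : ∀ n : ℕ, U.symm ((antiSq A ^ n) v) = polyLp hB (monomial (2 * n) 1) := by
    intro n
    rw [LinearIsometryEquiv.symm_apply_eq, hU, aevalVec_monomial, one_smul, hA.antiSq_pow]
  have hsq : MemLp (fun s : ℝ => (s : ℂ) ^ 2) ∞ ρ :=
    memLp_of_continuous_of_ae_abs_le hB (by fun_prop) _
  have hUsq : ∀ x, U.symm (antiSq A x) = mulOp _ hsq (U.symm x) := by
    have : (U.symm.toContinuousLinearEquiv : X →L[ℂ] Lp ℂ 2 ρ).comp (antiSq A)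
        = (mulOp _ hsq).comp (U.symm.toContinuousLinearEquiv : X →L[ℂ] Lp ℂ 2 ρ) := by
      refine ext_of_cyclic hv fun n => ?_
      change U.symm (antiSq A ((antiSq A ^ n) v)) = mulOp _ hsq (U.symm ((antiSq A ^ n) v))
      have h1 : antiSq A ((antiSq A ^ n) v) = (antiSq A ^ (n + 1)) v := by
        rw [pow_succ']; rfl
      rw [h1, hUs, hUs]
      apply Lp.ext
      filter_upwards [coeFn_polyLp hB (monomial (2 * (n + 1)) 1),
        coeFn_polyLp hB (monomial (2 * n) 1), coeFn_mulOp _ hsq (polyLp hB (monomial (2 * n) 1))]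
        with s h1 h2 h3
      rw [h1, h3, h2]
      simp only [eval_monomial]
      ring
    exact fun x => congrArg (fun F => F x) this
  have hUpow : ∀ (n : ℕ) x, (U.symm ((antiSq A ^ n) x) : ℝ → ℂ) =ᵐ[ρ]
      fun s => (s : ℂ) ^ (2 * n) * (U.symm x : ℝ → ℂ) s := by
    intro n
    induction n with
    | zero => intro x; simp
    | succ n ih =>
      intro x
      rw [pow_succ]
      filter_upwards [ih (antiSq A x), coeFn_mulOp _ hsq (U.symm x)] with s h1 h2
      rw [mul_apply_eq_comp, h1, hUsq, h2]
      ring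
  -- This vector determines `A`: since `A` commutes with `A²`, it sends `A²ⁿ v` to `A²ⁿ A v`, that
  -- is, `s²ⁿ` to `s²ⁿ g`.
  set g : Lp ℂ 2 ρ := U.symm (A v) with hg
  have key : ∀ x, (U.symm (A x) : ℝ → ℂ) =ᵐ[ρ]
      fun s => (g : ℝ → ℂ) s * conj ((U.symm x : ℝ → ℂ) s) := by
    -- A product with `g` is a priori only in `L¹`, so the two maps are compared there;
    -- multiplication by the polynomial `1` embeds `L²` in `L¹`.
    have : ((mulL1 (polyLp hB 1)).comp (U.symm.toContinuousLinearEquiv : X →L[ℂ] Lp ℂ 2 ρ)).comp A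
        = ((mulL1 g).comp (conjLp ρ)).comp
          (U.symm.toContinuousLinearEquiv : X →L[ℂ] Lp ℂ 2 ρ) := by
      refine ext_of_cyclic hv fun n => ?_
      change mulL1 (polyLp hB 1) (U.symm (A ((antiSq A ^ n) v)))
        = mulL1 g (conjLp ρ (U.symm ((antiSq A ^ n) v)))
      rw [antiSq_pow_comm]
      apply Lp.ext
      filter_upwards [coeFn_mulL1 (polyLp hB 1) (U.symm ((antiSq A ^ n) (A v))),
        coeFn_mulL1 g (conjLp ρ (U.symm ((antiSq A ^ n) v))),
        coeFn_conjLp (U.symm ((antiSq A ^ n) v)), coeFn_polyLp hB 1, hUpow n (A v),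
        coeFn_polyLp hB (monomial (2 * n) 1)] with s h1 h2 h3 h4 h5 h6
      rw [h1, h2, h3, h4, h5, hUs, h6]
      simp only [eval_one, eval_monomial, map_mul, map_pow, Complex.conj_ofReal, map_one]
      ring
    intro x
    have hx : mulL1 (polyLp hB 1) (U.symm (A x)) = mulL1 g (conjLp ρ (U.symm x)) :=
      congrArg (fun F => F x) this
    have hx1 := coeFn_mulL1 (polyLp hB 1) (U.symm (A x))
    rw [hx] at hx1
    filter_upwards [hx1, coeFn_mulL1 g (conjLp ρ (U.symm x)), coeFn_conjLp (U.symm x),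
      coeFn_polyLp hB 1] with s h1 h2 h3 h4
    rw [h2, h3, h4] at h1
    simpa using h1.symm
  -- Evaluating `A (A v)` in two ways gives `|g|² = s²`.
  have hgabs : ∀ᵐ s ∂ρ, ‖(g : ℝ → ℂ) s‖ = |s| := by
    have h0 := hUs 0
    rw [pow_zero, one_apply_eq_self, mul_zero] at h0
    have hx := hUsq v
    rw [antiSq_apply] at hx
    have h1 := key (A v)
    rw [hx, h0] at h1
    filter_upwards [h1, coeFn_mulOp _ hsq (polyLp hB (monomial 0 1)),
      coeFn_polyLp hB (monomial 0 1)] with s h1 h2 h3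
    rw [h2, h3, ← hg, Complex.mul_conj] at h1
    simp only [eval_monomial, pow_zero, mul_one] at h1
    have h4 : s ^ 2 = Complex.normSq ((g : ℝ → ℂ) s) := by exact_mod_cast h1
    rw [Complex.normSq_eq_norm_sq, ← sq_abs s] at h4
    exact ((sq_eq_sq₀ (abs_nonneg _) (norm_nonneg _)).1 h4).symm
  have hgm : Measurable (g : ℝ → ℂ) := (Lp.stronglyMeasurable g).measurable
  classical
  -- The default value `1`, at `0` and on the exceptional null set, makes `ψ` unimodular everywhere.
  let ψ : ℝ → ℂ := fun s => if ‖(g : ℝ → ℂ) s‖ = |s| ∧ s ≠ 0 then (g : ℝ → ℂ) s / s else 1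
  refine ⟨ρ, ψ, ?_, ?_, hρ, U, fun p => ⟨memLp_eval hB p 2, hU p⟩, fun f => ?_⟩
  · refine Measurable.ite ?_ (by fun_prop) (by fun_prop)
    exact (measurableSet_eq_fun (by fun_prop) (by fun_prop)).inter
      (measurableSet_singleton (0 : ℝ)).compl
  · intro s
    by_cases h : ‖(g : ℝ → ℂ) s‖ = |s| ∧ s ≠ 0
    · simp only [ψ, if_pos h, norm_div, h.1, Complex.norm_real, Real.norm_eq_abs]
      exact div_self (abs_ne_zero.2 h.2)
    · simp only [ψ, if_neg h, norm_one]
  · filter_upwards [key (U f), hgabs] with s h1 h2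
    rw [h1, LinearIsometryEquiv.symm_apply_apply]
    congr 1
    by_cases hs : s = 0
    · subst hs
      rw [abs_zero, norm_eq_zero] at h2
      simp [h2]
    · simp only [ψ, if_pos (And.intro h2 hs)]
      rw [mul_div_cancel₀]
      exact_mod_cast hs

end Models

/-! ### The conjugation attached to a model. -/

section ModelConjugation

variable {X : Type*} [NormedAddCommGroup X] [InnerProductSpace ℂ X]
variable {ρ : Measure ℝ} (U : Lp ℂ 2 ρ ≃ₗᵢ[ℂ] X)

/-- The conjugation of `X` which corresponds to the complex conjugation of `L²(ρ)`. -/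
def conjOn : X →L⋆[ℂ] X :=
  ((U.toContinuousLinearEquiv : Lp ℂ 2 ρ →L[ℂ] X).comp (conjLp ρ)).comp
    (U.symm.toContinuousLinearEquiv : X →L[ℂ] Lp ℂ 2 ρ)

lemma conjOn_apply (x : X) : conjOn U x = U (conjLp ρ (U.symm x)) := rfl

lemma symm_conjOn (x : X) : U.symm (conjOn U x) = conjLp ρ (U.symm x) := by
  rw [conjOn_apply, LinearIsometryEquiv.symm_apply_apply]

lemma inner_conjOn (x y : X) : ⟪conjOn U x, conjOn U y⟫_ℂ = ⟪y, x⟫_ℂ := by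
  rw [conjOn_apply, conjOn_apply, LinearIsometryEquiv.inner_map_map, inner_conjLp,
    LinearIsometryEquiv.inner_map_map]

variable {U}

lemma ext_symm {x y : X} (h : (U.symm x : ℝ → ℂ) =ᵐ[ρ] U.symm y) : x = y :=
  U.symm.injective (Lp.ext h)

lemma conjOn_eq_self {v : X} (hv : (U.symm v : ℝ → ℂ) =ᵐ[ρ] fun _ => 1) : conjOn U v = v := by
  apply ext_symm (U := U)
  rw [symm_conjOn]
  filter_upwards [hv, coeFn_conjLp (U.symm v)] with s h1 h2
  rw [h2, h1, map_one]

variable {A : X →L⋆[ℂ] X} {ψ : ℝ → ℂ}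
  (hUA : ∀ f : Lp ℂ 2 ρ, (U.symm (A (U f)) : ℝ → ℂ) =ᵐ[ρ]
    fun s => (s : ℂ) * ψ s * conj ((f : ℝ → ℂ) s))
  (hs : ∀ᵐ s ∂ρ, 0 ≤ s) (hψ : ∀ᵐ s ∂ρ, 0 < s → ‖ψ s‖ = 1)

include hUA

lemma symm_apply_model (x : X) : (U.symm (A x) : ℝ → ℂ) =ᵐ[ρ]
    fun s => (s : ℂ) * ψ s * conj ((U.symm x : ℝ → ℂ) s) := by
  simpa using hUA (U.symm x)

include hs hψ

/-- Applying the model twice produces `s² |ψ|²`; at `s = 0` the factor `s` makes the value of `ψ`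
irrelevant. -/
lemma symm_antiSq_model (x : X) : (U.symm (antiSq A x) : ℝ → ℂ) =ᵐ[ρ]
    fun s => (s : ℂ) ^ 2 * (U.symm x : ℝ → ℂ) s := by
  filter_upwards [symm_apply_model hUA (A x), symm_apply_model hUA x, hs, hψ] with s h1 h2 h3 h4
  rw [antiSq_apply, h1, h2]
  rcases h3.eq_or_lt with h | h
  · simp [← h]
  · have h5 : ψ s * conj (ψ s) = 1 := by
      rw [Complex.mul_conj, Complex.normSq_eq_norm_sq, h4 h]
      simp
    simp only [map_mul, Complex.conj_ofReal, Complex.conj_conj]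
    linear_combination (s : ℂ) ^ 2 * (U.symm x : ℝ → ℂ) s * h5

lemma conjOn_antiSq (x : X) : conjOn U (antiSq A x) = antiSq A (conjOn U x) := by
  apply ext_symm (U := U)
  rw [symm_conjOn]
  filter_upwards [coeFn_conjLp (U.symm (antiSq A x)), symm_antiSq_model hUA hs hψ x,
    symm_antiSq_model hUA hs hψ (conjOn U x), coeFn_conjLp (U.symm x)] with s h1 h2 h3 h4
  rw [h1, h2, h3, symm_conjOn, h4]
  simp

/-- The model function is real on `(0, ∞)` if and only if `A v` is fixed by the conjugation. -/
lemma conjOn_apply_eq_iff {v : X} (hv : (U.symm v : ℝ → ℂ) =ᵐ[ρ] fun _ => 1) :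
    conjOn U (A v) = A v ↔ ∀ᵐ s ∂ρ, 0 < s → ψ s = 1 ∨ ψ s = -1 := by
  constructor
  · intro h
    have h0 := symm_conjOn U (A v)
    rw [h] at h0
    have h1 := coeFn_conjLp (U.symm (A v))
    rw [← h0] at h1
    filter_upwards [h1, symm_apply_model hUA v, hψ, hv] with s h1 h2 h3 h4 h5
    rw [h2, h4] at h1
    simp only [map_one, mul_one, map_mul, Complex.conj_ofReal] at h1
    have h6 : conj (ψ s) = ψ s :=
      (mul_left_cancel₀ (Complex.ofReal_ne_zero.2 h5.ne') h1).symm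
    obtain ⟨r, hr⟩ := Complex.conj_eq_iff_real.1 h6
    have h7 := h3 h5
    rw [hr, Complex.norm_real, Real.norm_eq_abs] at h7
    rw [hr]
    rcases eq_or_eq_neg_of_abs_eq h7 with h8 | h8 <;> simp [h8]
  · intro h
    apply ext_symm (U := U)
    rw [symm_conjOn]
    filter_upwards [coeFn_conjLp (U.symm (A v)), symm_apply_model hUA v, h, hv, hs]
      with s h1 h2 h3 h4 h5
    rw [h1, h2, h4]
    rcases h5.eq_or_lt with h | h
    · simp [← h]
    · rcases h3 h with h6 | h6 <;> simp [h6]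

-- The model factor `s` makes `A` annihilate the indicator of `{0}`, so for injective `A` the
-- measure has no atom there.
omit hs hψ in
lemma ae_ne_zero_of_injective [IsFiniteMeasure ρ] (hinj : ∀ x, A x = 0 → x = 0) :
    ∀ᵐ s ∂ρ, s ≠ 0 := by
  set f : Lp ℂ 2 ρ := indicatorConstLp 2 (measurableSet_singleton (0 : ℝ))
    (measure_ne_top ρ _) (1 : ℂ)
  have hf : (f : ℝ → ℂ) =ᵐ[ρ] _ := indicatorConstLp_coeFn
  have h1 : U.symm (A (U f)) = 0 := by
    apply Lp.ext
    filter_upwards [hUA f, hf, Lp.coeFn_zero ℂ 2 ρ] with s h1 h2 h3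
    rw [h1, h2, h3]
    by_cases h : s = 0 <;> simp [h]
  have h2 : f = 0 := by
    have := hinj (U f) (by simpa using h1)
    simpa using this
  rw [h2] at hf
  filter_upwards [hf, Lp.coeFn_zero ℂ 2 ρ] with s h3 h4 h5
  rw [h4] at h3
  simp [h5] at h3

end ModelConjugation

/-! ### Commutation and uniqueness from cyclic vectors. -/

section CyclicVectors

variable {X : Type*} [NormedAddCommGroup X] [InnerProductSpace ℂ X]

/-- An antilinear operator which fixes a cyclic vector and commutes with `T` is unique. -/
lemma conj_unique {T : X →L[ℂ] X} {v : X}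
    (hv : (Submodule.span ℂ (Set.range fun n : ℕ => (T ^ n) v)).topologicalClosure = ⊤)
    {J K : X →L⋆[ℂ] X} (hJv : J v = v) (hKv : K v = v) (hJ : ∀ x, J (T x) = T (J x))
    (hK : ∀ x, K (T x) = T (K x)) : J = K := by
  have h : ∀ {L : X →L⋆[ℂ] X}, L v = v → (∀ x, L (T x) = T (L x)) →
      ∀ n : ℕ, L ((T ^ n) v) = (T ^ n) v := by
    intro L hLv hL n
    induction n with
    | zero => exact hLv
    | succ n ih =>
      rw [pow_succ']
      exact (hL _).trans (congrArg T ih)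
  exact ext_of_cyclic hv fun n => (h hJv hJ n).trans (h hKv hK n).symm

lemma apply_pow_comm {T : X →L[ℂ] X} {σ : ℂ →+* ℂ} {L : X →SL[σ] X}
    (hL : ∀ x, L (T x) = T (L x)) (n : ℕ) (x : X) : L ((T ^ n) x) = (T ^ n) (L x) := by
  induction n generalizing x with
  | zero => rfl
  | succ n ih =>
    rw [pow_succ]
    exact (ih (T x)).trans (congrArg _ (hL x))

variable [CompleteSpace X]

-- Both `J` and `A` pass through the powers of `A²`, so the two products agree on the orbit of `v`
-- as soon as they agree at `v`.
omit [CompleteSpace X] in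
lemma apply_comm_of_conj {A : X →L⋆[ℂ] X} {v : X}
    (hv : (Submodule.span ℂ (Set.range fun n : ℕ => (antiSq A ^ n) v)).topologicalClosure = ⊤)
    {J : X →L⋆[ℂ] X} (hJv : J v = v) (hJ : ∀ x, J (antiSq A x) = antiSq A (J x))
    (hJA : J (A v) = A v) (x : X) : J (A x) = A (J x) := by
  have : J.comp A = A.comp J := by
    refine ext_of_cyclic hv fun n => ?_
    change J (A ((antiSq A ^ n) v)) = A (J ((antiSq A ^ n) v))
    rw [antiSq_pow_comm, apply_pow_comm hJ, apply_pow_comm hJ, antiSq_pow_comm, hJA, hJv]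
  exact congrArg (fun F => F x) this

/-- If `A²` has a cyclic vector, then a self-adjoint operator which commutes with `A²` commutes
with `A`. -/
lemma IsSymmAnti.comm_of_hasSimpleSpectrum {A : X →L⋆[ℂ] X} (hA : IsSymmAnti A)
    (hs : HasSimpleSpectrum (antiSq A)) {P : X →L[ℂ] X} (hP : ∀ x y, ⟪P x, y⟫_ℂ = ⟪x, P y⟫_ℂ)
    (hPA : ∀ x, P (antiSq A x) = antiSq A (P x)) (x : X) : P (A x) = A (P x) := by
  obtain ⟨v, hv⟩ := hs
  have hsa : IsSelfAdjoint (antiSq A) := hA.isPositive_antiSq.isSelfAdjoint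
  have h0 : P (A v) = A (P v) := by
    rw [← sub_eq_zero]
    set z := P (A v) - A (P v) with hz
    -- Against `A²ⁿ v`, both terms of `z` give `⟪A v, A²ⁿ P v⟫`: the first by self-adjointness of
    -- `P`, the second by the anti-linear symmetry of `A`.
    have h1 : innerSL ℂ z = 0 := by
      refine ext_of_cyclic hv fun n => ?_
      rw [innerSL_apply_apply, hz, inner_sub_left, hP, apply_pow_comm hPA, hA, antiSq_pow_comm,
        zero_apply, sub_eq_zero]
      exact (ContinuousLinearMap.isSelfAdjoint_iff_isSymmetric.1 (hsa.pow n)) _ _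
    have h2 : innerSL ℂ z z = 0 := by rw [h1, zero_apply]
    rwa [innerSL_apply_apply, inner_self_eq_zero] at h2
  have : P.comp A = A.comp P := by
    refine ext_of_cyclic hv fun n => ?_
    change P (A ((antiSq A ^ n) v)) = A (P ((antiSq A ^ n) v))
    rw [antiSq_pow_comm, apply_pow_comm hPA, apply_pow_comm hPA, antiSq_pow_comm, h0]
  exact congrArg (fun F => F x) this

/-- A vector is cyclic if no non-zero reducing subspace is orthogonal to it. -/
lemma cyclic_of_forall_projection {T : X →L[ℂ] X} (hT : ∀ x y, ⟪T x, y⟫_ℂ = ⟪x, T y⟫_ℂ) {v : X}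
    (h : ∀ P : X →L[ℂ] X, (∀ x y, ⟪P x, y⟫_ℂ = ⟪x, P y⟫_ℂ) → (∀ x, P (T x) = T (P x)) →
      P v = 0 → P = 0) :
    (Submodule.span ℂ (Set.range fun n : ℕ => (T ^ n) v)).topologicalClosure = ⊤ := by
  set K := Submodule.span ℂ (Set.range fun n : ℕ => (T ^ n) v) with hK
  have hTK : ∀ k ∈ K, T k ∈ K := by
    have : K ≤ K.comap (T : X →ₗ[ℂ] X) := by
      rw [hK, Submodule.span_le]
      rintro _ ⟨n, rfl⟩
      refine Submodule.subset_span ⟨n + 1, ?_⟩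
      simp only [pow_succ']
      rfl
    exact this
  have horth : ∀ (L : Submodule ℂ X), (∀ k ∈ L, T k ∈ L) → ∀ y ∈ Lᗮ, T y ∈ Lᗮ := by
    intro L hL y hy
    rw [Submodule.mem_orthogonal] at hy ⊢
    intro k hk
    rw [← hT]
    exact hy _ (hL k hk)
  have h1 := horth K hTK
  have h2 := horth Kᗮ h1
  -- The projection onto `Kᗮ` commutes with `T` because `Kᗮ` and `Kᗮᗮ` are both invariant, and it
  -- kills `v ∈ K`.
  have hP := h Kᗮ.starProjection (fun x y => Kᗮ.inner_starProjection_left_eq_right x y)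
    (fun x => by
      refine Submodule.eq_starProjection_of_mem_orthogonal (h1 _ (Kᗮ.starProjection_apply_mem x)) ?_
      rw [← map_sub]
      exact h2 _ (Kᗮ.sub_starProjection_mem_orthogonal x))
    (by
      rw [Submodule.starProjection_apply_eq_zero_iff]
      exact K.le_orthogonal_orthogonal (Submodule.subset_span ⟨0, rfl⟩))
  rw [Submodule.topologicalClosure_eq_top_iff, Submodule.eq_bot_iff]
  intro y hy
  rw [← Submodule.starProjection_eq_self_iff.2 hy, hP, zero_apply]

end CyclicVectors

/-! ### Coefficients, shift and conjugation on the Hardy space. -/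

section HardyBasis

lemma inner_zpw (n : ℕ) (f : H2) :
    ⟪zpw n, f⟫_ℂ = fourierCoeff (H2.incl f : Circ → ℂ) (n : ℤ) := by
  rw [fourierCoeff_eq_inner]
  exact (H2.incl.inner_map_map (zpw n) f).symm

lemma eq_zero_of_inner_zpw {x : H2} (h : ∀ n, ⟪zpw n, x⟫_ℂ = 0) : x = 0 := by
  apply H2.incl.injective
  rw [map_zero]
  apply (fourierBasis (T := 2 * Real.pi)).repr.injective
  rw [map_zero]
  ext n
  rw [fourierBasis_repr]
  rcases lt_or_ge n 0 with hn | hn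
  · exact H2.incl_mem x n hn
  · lift n to ℕ using hn
    rw [← inner_zpw]
    exact h n

lemma H2.ext_inner {x y : H2} (h : ∀ n, ⟪zpw n, x⟫_ℂ = ⟪zpw n, y⟫_ℂ) : x = y := by
  rw [← sub_eq_zero]
  refine eq_zero_of_inner_zpw fun n => ?_
  rw [inner_sub_right, h, sub_self]

lemma dense_span_zpw : Dense (Submodule.span ℂ (Set.range zpw) : Set H2) := by
  rw [Submodule.dense_iff_topologicalClosure_eq_top, Submodule.topologicalClosure_eq_top_iff,
    Submodule.eq_bot_iff]
  intro y hy
  refine eq_zero_of_inner_zpw fun n => ?_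
  exact (Submodule.mem_orthogonal _ _).1 hy _ (Submodule.subset_span ⟨n, rfl⟩)

lemma H2.ext_zpw {Y : Type*} [NormedAddCommGroup Y] [NormedSpace ℂ Y] {σ : ℂ →+* ℂ}
    {F G : H2 →SL[σ] Y} (h : ∀ n, F (zpw n) = G (zpw n)) : F = G := by
  refine ContinuousLinearMap.ext_on dense_span_zpw ?_
  rintro _ ⟨n, rfl⟩
  exact h n

lemma inner_zpw_zpw (j k : ℕ) : ⟪zpw j, zpw k⟫_ℂ = if j = k then 1 else 0 := by
  have h := orthonormal_iff_ite.1 (orthonormal_fourier (T := 2 * Real.pi)) (j : ℤ) (k : ℤ)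
  simp only [Nat.cast_inj] at h
  exact h

lemma inner_zpw_shift_zero (f : H2) : ⟪zpw 0, shift f⟫_ℂ = 0 := by
  rw [inner_zpw]
  exact (fourierCoeff_mulZ (H2.incl f) _).trans (H2.incl_mem f _ (by simp))

lemma inner_zpw_shift_succ (n : ℕ) (f : H2) : ⟪zpw (n + 1), shift f⟫_ℂ = ⟪zpw n, f⟫_ℂ := by
  rw [inner_zpw, inner_zpw]
  refine (fourierCoeff_mulZ (H2.incl f) _).trans ?_
  congr 1
  push_cast
  ring

lemma shift_zpw (n : ℕ) : shift (zpw n) = zpw (n + 1) := by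
  refine H2.ext_inner fun k => ?_
  cases k with
  | zero => rw [inner_zpw_shift_zero, inner_zpw_zpw]; simp
  | succ k => rw [inner_zpw_shift_succ, inner_zpw_zpw, inner_zpw_zpw]; simp

lemma inner_zpw_conjH (n : ℕ) (f : H2) : ⟪zpw n, conjH f⟫_ℂ = conj ⟪zpw n, f⟫_ℂ := by
  rw [inner_zpw, inner_zpw]
  exact fourierCoeff_conjL2 (H2.incl f) _

lemma conjH_conjH (f : H2) : conjH (conjH f) = f := by
  refine H2.ext_inner fun n => ?_
  rw [inner_zpw_conjH, inner_zpw_conjH, Complex.conj_conj]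

end HardyBasis

/-! ### Hankel operators, the rank-one identity and cyclicity of the symbol. -/

section Hankel

variable {Γ : H2 →L[ℂ] H2}

lemma antiH_apply (Γ : H2 →L[ℂ] H2) (f : H2) : antiH Γ f = Γ (conjH f) := rfl

lemma antiH_zpw (Γ : H2 →L[ℂ] H2) (n : ℕ) : antiH Γ (zpw n) = Γ (zpw n) := by
  rw [antiH_apply, conjH_zpw]

lemma antiH_zpw_zero (Γ : H2 →L[ℂ] H2) : antiH Γ (zpw 0) = symbol Γ := antiH_zpw Γ 0

/-- The matrix `γ (j + k)` is symmetric. Both sides are anti-linear in `x` and in `y`, so the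
identity extends from the basis one variable at a time. -/
lemma IsHankel.inner_antiH (hΓ : IsHankel Γ) (x y : H2) :
    ⟪y, antiH Γ x⟫_ℂ = ⟪x, antiH Γ y⟫_ℂ := by
  obtain ⟨γ, hγ⟩ := hΓ
  have h1 : ∀ (k : ℕ) (y : H2), ⟪y, antiH Γ (zpw k)⟫_ℂ = ⟪zpw k, antiH Γ y⟫_ℂ := by
    intro k y
    have : ((starL ℂ : ℂ ≃L⋆[ℂ] ℂ) : ℂ →L⋆[ℂ] ℂ).comp (innerSL ℂ (antiH Γ (zpw k)))
        = (innerSL ℂ (zpw k)).comp (antiH Γ) := by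
      refine H2.ext_zpw fun j => ?_
      change conj ⟪antiH Γ (zpw k), zpw j⟫_ℂ = ⟪zpw k, antiH Γ (zpw j)⟫_ℂ
      rw [inner_conj_symm, antiH_zpw, antiH_zpw, hγ, hγ, add_comm]
    have h := congrArg (fun F => F y) this
    change conj ⟪antiH Γ (zpw k), y⟫_ℂ = ⟪zpw k, antiH Γ y⟫_ℂ at h
    rwa [inner_conj_symm] at h
  have : (innerSL ℂ y).comp (antiH Γ)
      = ((starL ℂ : ℂ ≃L⋆[ℂ] ℂ) : ℂ →L⋆[ℂ] ℂ).comp (innerSL ℂ (antiH Γ y)) := by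
    refine H2.ext_zpw fun k => ?_
    change ⟪y, antiH Γ (zpw k)⟫_ℂ = conj ⟪antiH Γ y, zpw k⟫_ℂ
    rw [inner_conj_symm, h1]
  have h := congrArg (fun F => F x) this
  change ⟪y, antiH Γ x⟫_ℂ = conj ⟪antiH Γ y, x⟫_ℂ at h
  rwa [inner_conj_symm] at h

lemma IsHankel.isSymmAnti (hΓ : IsHankel Γ) : IsSymmAnti (antiH Γ) := by
  intro x y
  rw [← inner_conj_symm, hΓ.inner_antiH, inner_conj_symm]

lemma IsHankel.isHankel_trunc (hΓ : IsHankel Γ) : IsHankel (trunc Γ) := by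
  obtain ⟨γ, hγ⟩ := hΓ
  refine ⟨fun n => γ (n + 1), fun j k => ?_⟩
  change ⟪zpw j, Γ (shift (zpw k))⟫_ℂ = _
  rw [shift_zpw, hγ, ← add_assoc]

/-- The conjugation commutes with the shift. Facts about anti-linear Hankel operators thereby apply
to the truncated one. -/
lemma antiHTrunc_eq (Γ : H2 →L[ℂ] H2) : antiHTrunc Γ = antiH (trunc Γ) := by
  refine H2.ext_zpw fun n => ?_
  rw [antiH_zpw]
  change antiH Γ (shift (zpw n)) = Γ (shift (zpw n))
  rw [shift_zpw, antiH_zpw]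

lemma antiHTrunc_zpw (Γ : H2 →L[ℂ] H2) (n : ℕ) : antiHTrunc Γ (zpw n) = Γ (zpw (n + 1)) := by
  change antiH Γ (shift (zpw n)) = _
  rw [shift_zpw, antiH_zpw]

/-- This is `S* H_u = H_u S` in coordinates. -/
lemma IsHankel.inner_zpw_antiHTrunc (hΓ : IsHankel Γ) (n : ℕ) (f : H2) :
    ⟪zpw n, antiHTrunc Γ f⟫_ℂ = ⟪zpw (n + 1), antiH Γ f⟫_ℂ := by
  rw [antiHTrunc_eq, hΓ.isHankel_trunc.inner_antiH, ← antiHTrunc_eq, antiHTrunc_zpw, ← antiH_zpw,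
    hΓ.inner_antiH]

lemma IsHankel.shift_antiHTrunc (hΓ : IsHankel Γ) (f : H2) :
    shift (antiHTrunc Γ f) = antiH Γ f - ⟪zpw 0, antiH Γ f⟫_ℂ • zpw 0 := by
  refine H2.ext_inner fun n => ?_
  rw [inner_sub_right, inner_smul_right, inner_zpw_zpw]
  cases n with
  | zero => rw [inner_zpw_shift_zero]; simp
  | succ n => rw [inner_zpw_shift_succ, hΓ.inner_zpw_antiHTrunc]; simp

/-- Write the square as `H_u S S* H_u`, where `S S*` removes the zeroth coefficient; `H_u` carries
the removed multiple of `z ^ 0` to a multiple of the symbol. -/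
lemma IsHankel.antiHTrunc_antiHTrunc (hΓ : IsHankel Γ) (f : H2) :
    antiHTrunc Γ (antiHTrunc Γ f) = antiH Γ (antiH Γ f) - ⟪symbol Γ, f⟫_ℂ • symbol Γ := by
  have h : antiHTrunc Γ (antiHTrunc Γ f) = antiH Γ (shift (antiHTrunc Γ f)) := rfl
  rw [h, hΓ.shift_antiHTrunc, map_sub, map_smulₛₗ, antiH_zpw_zero, inner_conj_symm,
    hΓ.isSymmAnti, antiH_zpw_zero]

/-! ### The essential parts -/

lemma coe_essH (Γ : H2 →L[ℂ] H2) (x : essSpace Γ) : (essH Γ x : H2) = antiH Γ x := rfl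

lemma coe_essHTrunc (Γ : H2 →L[ℂ] H2) (x : essSpace Γ) :
    (essHTrunc Γ x : H2) = antiHTrunc Γ x := rfl

lemma coe_symbolEss (Γ : H2 →L[ℂ] H2) : (symbolEss Γ : H2) = symbol Γ := rfl

lemma IsHankel.isSymmAnti_essH (hΓ : IsHankel Γ) : IsSymmAnti (essH Γ) :=
  fun x y => hΓ.isSymmAnti x y

lemma IsHankel.isSymmAnti_essHTrunc (hΓ : IsHankel Γ) : IsSymmAnti (essHTrunc Γ) := by
  intro x y
  have h := hΓ.isHankel_trunc.isSymmAnti x y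
  rw [← antiHTrunc_eq] at h
  exact h

lemma IsHankel.antiSq_essHTrunc (hΓ : IsHankel Γ) (x : essSpace Γ) :
    antiSq (essHTrunc Γ) x
      = antiSq (essH Γ) x - ⟪symbolEss Γ, x⟫_ℂ • symbolEss Γ :=
  Subtype.ext (hΓ.antiHTrunc_antiHTrunc x)

lemma IsHankel.antiH_eq_zero (hΓ : IsHankel Γ) {x : H2} (hx : x ∈ (essSpace Γ)ᗮ) :
    antiH Γ x = 0 := by
  rw [← inner_self_eq_zero (𝕜 := ℂ), hΓ.isSymmAnti]
  exact (Submodule.mem_orthogonal _ _).1 hx _ (antiH_mem_essSpace Γ _)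

/-- By symmetry the kernel of `H_u` is orthogonal to its range, while `x` lies in the closure of
that range. -/
lemma IsHankel.essH_injective (hΓ : IsHankel Γ) (x : essSpace Γ) (hx : essH Γ x = 0) : x = 0 := by
  have h0 : antiH Γ x = 0 := by rw [← coe_essH, hx]; rfl
  have h1 : (x : H2) ∈ (LinearMap.range (antiH Γ : H2 →ₛₗ[starRingEnd ℂ] H2))ᗮ := by
    rw [Submodule.mem_orthogonal]
    rintro _ ⟨y, rfl⟩
    change ⟪antiH Γ y, x⟫_ℂ = 0
    rw [hΓ.isSymmAnti, h0, inner_zero_left]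
  rw [← Submodule.orthogonal_closure] at h1
  have h2 := (Submodule.mem_orthogonal _ _).1 h1 x x.2
  rw [inner_self_eq_zero] at h2
  exact Subtype.ext h2

/-- The orthogonal projection of `z ^ n` on the closure of the range of `H_u`. -/
def zpwEss (Γ : H2 →L[ℂ] H2) (n : ℕ) : essSpace Γ :=
  ⟨(essSpace Γ).starProjection (zpw n), Submodule.starProjection_apply_mem _ _⟩

lemma inner_zpwEss (n : ℕ) (x : essSpace Γ) : ⟪zpwEss Γ n, x⟫_ℂ = ⟪zpw n, (x : H2)⟫_ℂ := by
  change ⟪(essSpace Γ).starProjection (zpw n), (x : H2)⟫_ℂ = _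
  rw [Submodule.inner_starProjection_left_eq_right, Submodule.starProjection_eq_self_iff.2 x.2]

lemma IsHankel.essH_zpwEss_zero (hΓ : IsHankel Γ) : essH Γ (zpwEss Γ 0) = symbolEss Γ := by
  apply Subtype.ext
  rw [coe_essH, coe_symbolEss, ← antiH_zpw_zero, ← sub_eq_zero, ← map_sub]
  apply hΓ.antiH_eq_zero
  rw [← neg_sub]
  exact Submodule.neg_mem _ (Submodule.sub_starProjection_mem_orthogonal _)

/-- Because `P` kills the symbol, the rank-one identity makes it commute with both squares, and
simplicity makes it commute with both anti-linear operators. Induction on `n` then shows that it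
kills the projected basis vectors. -/
lemma IsHankel.projection_eq_zero (hΓ : IsHankel Γ) (hs : IsSimple Γ)
    {P : essSpace Γ →L[ℂ] essSpace Γ} (hP : ∀ x y, ⟪P x, y⟫_ℂ = ⟪x, P y⟫_ℂ)
    (hPA : ∀ x, P (antiSq (essH Γ) x) = antiSq (essH Γ) (P x)) (hPv : P (symbolEss Γ) = 0) :
    P = 0 := by
  have hPB : ∀ x, P (antiSq (essHTrunc Γ) x) = antiSq (essHTrunc Γ) (P x) := by
    intro x
    rw [hΓ.antiSq_essHTrunc, hΓ.antiSq_essHTrunc, map_sub, map_smul, hPv, hPA, ← hP, hPv]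
    simp
  have hA := hΓ.isSymmAnti_essH.comm_of_hasSimpleSpectrum hs.1 hP hPA
  have hB := hΓ.isSymmAnti_essHTrunc.comm_of_hasSimpleSpectrum hs.2 hP hPB
  have hz : ∀ n, P (zpwEss Γ n) = 0 := by
    intro n
    induction n with
    | zero =>
      apply hΓ.essH_injective
      rw [← hA, hΓ.essH_zpwEss_zero, hPv]
    | succ n ih =>
      -- With `y = H P zₙ₊₁`, the squared norm of `y` is the conjugate of `⟪zₙ₊₁, H P y⟫ = ⟪zₙ, H' P
      -- y⟫ = ⟪P zₙ, H' y⟫`, which vanishes by induction.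
      apply hΓ.essH_injective
      rw [← inner_self_eq_zero (𝕜 := ℂ), hΓ.isSymmAnti_essH, ← inner_conj_symm, hP, hA,
        inner_zpwEss, coe_essH, ← hΓ.inner_zpw_antiHTrunc, ← coe_essHTrunc, ← hB,
        ← inner_zpwEss, ← hP, ih, inner_zero_left, map_zero]
  ext1 x
  apply Subtype.ext
  refine eq_zero_of_inner_zpw fun n => ?_
  rw [← inner_zpwEss, ← hP, hz, inner_zero_left]

lemma IsHankel.cyclic_essH (hΓ : IsHankel Γ) (hs : IsSimple Γ) :
    (Submodule.span ℂ (Set.range fun n : ℕ =>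
      (antiSq (essH Γ) ^ n) (symbolEss Γ))).topologicalClosure = ⊤ :=
  cyclic_of_forall_projection (hΓ.isSymmAnti_essH.isPositive_antiSq.1)
    fun _ hP hPA hPv => hΓ.projection_eq_zero hs hP hPA hPv

/-- For `P u = 0` the rank-one term drops out, so commuting with `H'²` is the same as commuting with
`H²`. -/
lemma IsHankel.cyclic_essHTrunc (hΓ : IsHankel Γ) (hs : IsSimple Γ) :
    (Submodule.span ℂ (Set.range fun n : ℕ =>
      (antiSq (essHTrunc Γ) ^ n) (symbolEss Γ))).topologicalClosure = ⊤ := by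
  refine cyclic_of_forall_projection (hΓ.isSymmAnti_essHTrunc.isPositive_antiSq.1)
    fun P hP hPB hPv => hΓ.projection_eq_zero hs hP (fun x => ?_) hPv
  have h1 := hPB x
  rw [hΓ.antiSq_essHTrunc, hΓ.antiSq_essHTrunc, map_sub, map_smul, hPv, ← hP, hPv] at h1
  simpa using h1

/-- The spectral data of a Hankel operator with simple spectrum exist. -/
theorem IsHankel.exists_isSpectralDatum (hΓ : IsHankel Γ) (hs : IsSimple Γ) :
    ∃ (ρ ρt : Measure ℝ) (Ψ Ψt : ℝ → ℂ), IsSpectralDatum Γ ρ ρt Ψ Ψt := by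
  obtain ⟨ρ, ψ, hm, hu, hmod⟩ := hΓ.isSymmAnti_essH.exists_model (hΓ.cyclic_essH hs)
  obtain ⟨ρt, ψt, hmt, hut, hmodt⟩ := hΓ.isSymmAnti_essHTrunc.exists_model (hΓ.cyclic_essHTrunc hs)
  refine ⟨ρ, ρt, fun s => conj (ψ s), ψt, by fun_prop, hmt, ae_of_all _ fun s => ?_,
    ae_of_all _ hut, ?_, hmodt⟩
  · rw [RCLike.norm_conj, hu]
  · simpa only [Complex.conj_conj] using hmod

end Hankel

/-! ### Self-adjointness as reality of the symbol. -/

section RealSymbol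

variable {Γ : H2 →L[ℂ] H2}

lemma IsHankel.inner_zpw_apply (hΓ : IsHankel Γ) (j k : ℕ) :
    ⟪zpw j, Γ (zpw k)⟫_ℂ = ⟪zpw (j + k), symbol Γ⟫_ℂ := by
  obtain ⟨γ, hγ⟩ := hΓ
  rw [hγ, symbol, hγ, add_zero]

/-- A symmetric matrix is Hermitian exactly when its entries are real, and the entries are the
coefficients of the symbol. -/
lemma IsHankel.isSelfAdjoint_iff (hΓ : IsHankel Γ) :
    IsSelfAdjoint Γ ↔ ∀ n, conj ⟪zpw n, symbol Γ⟫_ℂ = ⟪zpw n, symbol Γ⟫_ℂ := by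
  constructor
  · intro h n
    have h1 : ⟪Γ (zpw n), zpw 0⟫_ℂ = ⟪zpw n, Γ (zpw 0)⟫_ℂ :=
      (ContinuousLinearMap.isSelfAdjoint_iff_isSymmetric.1 h) _ _
    rw [← inner_conj_symm, hΓ.inner_zpw_apply, zero_add] at h1
    exact h1
  · intro h
    rw [ContinuousLinearMap.isSelfAdjoint_iff']
    refine H2.ext_zpw fun k => H2.ext_inner fun j => ?_
    rw [ContinuousLinearMap.adjoint_inner_right, ← inner_conj_symm, hΓ.inner_zpw_apply,
      hΓ.inner_zpw_apply, h, add_comm]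

lemma IsHankel.conjH_apply (hΓ : IsHankel Γ) (hsa : IsSelfAdjoint Γ) (f : H2) :
    conjH (Γ f) = Γ (conjH f) := by
  have : conjH.comp Γ = Γ.comp conjH := by
    refine H2.ext_zpw fun k => H2.ext_inner fun j => ?_
    change ⟪zpw j, conjH (Γ (zpw k))⟫_ℂ = ⟪zpw j, Γ (conjH (zpw k))⟫_ℂ
    rw [inner_zpw_conjH, conjH_zpw, hΓ.inner_zpw_apply, hΓ.isSelfAdjoint_iff.1 hsa]
  exact congrArg (fun F => F f) this

lemma IsHankel.conjH_antiH (hΓ : IsHankel Γ) (hsa : IsSelfAdjoint Γ) (f : H2) :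
    conjH (antiH Γ f) = antiH Γ (conjH f) :=
  hΓ.conjH_apply hsa (conjH f)

lemma IsHankel.isSelfAdjoint_trunc (hΓ : IsHankel Γ) (hsa : IsSelfAdjoint Γ) :
    IsSelfAdjoint (trunc Γ) := by
  rw [hΓ.isHankel_trunc.isSelfAdjoint_iff]
  intro n
  have h : symbol (trunc Γ) = Γ (zpw 1) := congrArg Γ (shift_zpw 0)
  rw [h, hΓ.inner_zpw_apply]
  exact hΓ.isSelfAdjoint_iff.1 hsa _

lemma IsHankel.conjH_mem_essSpace (hΓ : IsHankel Γ) (hsa : IsSelfAdjoint Γ) {x : H2}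
    (hx : x ∈ essSpace Γ) : conjH x ∈ essSpace Γ := by
  refine map_mem_closure conjH.continuous hx ?_
  rintro _ ⟨y, rfl⟩
  exact ⟨conjH y, (hΓ.conjH_antiH hsa y).symm⟩

/-- The restriction of the conjugation of the Hardy space to the closure of the range of `H_u`. -/
def conjEss (hΓ : IsHankel Γ) (hsa : IsSelfAdjoint Γ) : essSpace Γ →L⋆[ℂ] essSpace Γ :=
  (conjH.comp (essSpace Γ).subtypeL).codRestrict (essSpace Γ)
    (fun f => hΓ.conjH_mem_essSpace hsa f.2)

lemma coe_conjEss (hΓ : IsHankel Γ) (hsa : IsSelfAdjoint Γ) (x : essSpace Γ) :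
    (conjEss hΓ hsa x : H2) = conjH x := rfl

lemma conjEss_symbolEss (hΓ : IsHankel Γ) (hsa : IsSelfAdjoint Γ) :
    conjEss hΓ hsa (symbolEss Γ) = symbolEss Γ := by
  apply Subtype.ext
  rw [coe_conjEss, coe_symbolEss, symbol, hΓ.conjH_apply hsa, conjH_zpw]

lemma conjEss_essH (hΓ : IsHankel Γ) (hsa : IsSelfAdjoint Γ) (x : essSpace Γ) :
    conjEss hΓ hsa (essH Γ x) = essH Γ (conjEss hΓ hsa x) :=
  Subtype.ext (hΓ.conjH_antiH hsa x)

lemma conjEss_essHTrunc (hΓ : IsHankel Γ) (hsa : IsSelfAdjoint Γ) (x : essSpace Γ) :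
    conjEss hΓ hsa (essHTrunc Γ x) = essHTrunc Γ (conjEss hΓ hsa x) := by
  apply Subtype.ext
  have h := hΓ.isHankel_trunc.conjH_antiH (hΓ.isSelfAdjoint_trunc hsa) x
  rw [← antiHTrunc_eq] at h
  exact h

/-- The symbol is real if some conjugation fixes the symbol and commutes with both `H_u` and
`H_u S`. -/
lemma IsHankel.isSelfAdjoint_of_conj (hΓ : IsHankel Γ) {J : essSpace Γ →L⋆[ℂ] essSpace Γ}
    (hJJ : ∀ x, J (J x) = x) (hJ : ∀ x y, ⟪J x, J y⟫_ℂ = ⟪y, x⟫_ℂ)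
    (hJv : J (symbolEss Γ) = symbolEss Γ) (hJA : ∀ x, J (essH Γ x) = essH Γ (J x))
    (hJB : ∀ x, J (essHTrunc Γ x) = essHTrunc Γ (J x)) : IsSelfAdjoint Γ := by
  have hz : ∀ n, J (zpwEss Γ n) = zpwEss Γ n := by
    intro n
    induction n with
    | zero =>
      rw [← sub_eq_zero]
      apply hΓ.essH_injective
      rw [map_sub, ← hJA, hΓ.essH_zpwEss_zero, hJv, sub_self]
    | succ n ih =>
      have hx : ∀ x, ⟪zpwEss Γ (n + 1), essH Γ x⟫_ℂ = ⟪zpwEss Γ n, essHTrunc Γ x⟫_ℂ := by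
        intro x
        rw [inner_zpwEss, inner_zpwEss, coe_essH, coe_essHTrunc, hΓ.inner_zpw_antiHTrunc]
      have hx' : ∀ x, ⟪J (zpwEss Γ (n + 1)) - zpwEss Γ (n + 1), essH Γ x⟫_ℂ = 0 := by
        intro x
        -- Moving `J` across the inner product and through `H`, then lowering the index with `hx`,
        -- reduces the claim to `J zₙ = zₙ`.
        rw [inner_sub_left, sub_eq_zero, hx]
        conv_lhs => rw [← hJJ x, ← hJA, hJ, ← inner_conj_symm, hx, ← hJB]
        conv_lhs => rw [← ih, hJ, inner_conj_symm]
      rw [← sub_eq_zero]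
      apply hΓ.essH_injective
      rw [← inner_self_eq_zero (𝕜 := ℂ), hΓ.isSymmAnti_essH, ← inner_conj_symm, hx', map_zero]
  rw [hΓ.isSelfAdjoint_iff]
  intro n
  rw [← coe_symbolEss, ← inner_zpwEss, inner_conj_symm]
  conv_rhs => rw [← hJv, ← hz, hJ]

end RealSymbol

/-! ### The criterion for self-adjointness. -/

section SpectralDatum

lemma conjLp_conjLp {ρ : Measure ℝ} (f : Lp ℂ 2 ρ) : conjLp ρ (conjLp ρ f) = f := by
  apply Lp.ext
  filter_upwards [coeFn_conjLp (conjLp ρ f), coeFn_conjLp f] with s h1 h2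
  rw [h1, h2, Complex.conj_conj]

lemma conjOn_conjOn {X : Type*} [NormedAddCommGroup X] [InnerProductSpace ℂ X] {ρ : Measure ℝ}
    (U : Lp ℂ 2 ρ ≃ₗᵢ[ℂ] X) (x : X) : conjOn U (conjOn U x) = x := by
  rw [conjOn_apply, symm_conjOn, conjLp_conjLp, LinearIsometryEquiv.apply_symm_apply]

lemma IsAntilinearModel.exists_unitary {X : Type*} [NormedAddCommGroup X] [InnerProductSpace ℂ X]
    [CompleteSpace X] {A : X →L⋆[ℂ] X} {v : X} {ρ : Measure ℝ} {ψ : ℝ → ℂ}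
    (h : IsAntilinearModel A v ρ ψ) :
    (∀ᵐ s ∂ρ, 0 ≤ s) ∧ (∃ B : ℝ, ∀ᵐ s ∂ρ, |s| ≤ B) ∧ ∃ U : Lp ℂ 2 ρ ≃ₗᵢ[ℂ] X,
      ((U.symm v : ℝ → ℂ) =ᵐ[ρ] fun _ => 1) ∧
      ∀ f : Lp ℂ 2 ρ, (U.symm (A (U f)) : ℝ → ℂ) =ᵐ[ρ]
        fun s => (s : ℂ) * ψ s * conj ((f : ℝ → ℂ) s) := by
  obtain ⟨hρ, U, hU, hUA⟩ := h
  refine ⟨hρ.ae_nonneg (antiAbs_nonneg A), ⟨_, hρ.ae_abs_le⟩, U, ?_, hUA⟩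
  obtain ⟨hp, hU1⟩ := hU 1
  rw [map_one, one_apply_eq_self] at hU1
  rw [← hU1, LinearIsometryEquiv.symm_apply_apply]
  filter_upwards [hp.coeFn_toLp] with s hs
  rw [hs, eval_one]

variable {Γ : H2 →L[ℂ] H2} {ρ ρt : Measure ℝ} {Ψ Ψt : ℝ → ℂ}

lemma IsSpectralDatum.ae_norm (D : IsSpectralDatum Γ ρ ρt Ψ Ψt) :
    ∀ᵐ s ∂ρ, 0 < s → ‖conj (Ψ s)‖ = 1 := by
  filter_upwards [D.unimodular] with s hs _
  rw [RCLike.norm_conj, hs]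

lemma IsSpectralDatum.ae_norm_trunc (D : IsSpectralDatum Γ ρ ρt Ψ Ψt) :
    ∀ᵐ s ∂ρt, 0 < s → ‖Ψt s‖ = 1 :=
  (ae_restrict_iff' measurableSet_Ioi).1 D.unimodular_trunc

lemma conj_eq_one_or_neg_one {z : ℂ} : (conj z = 1 ∨ conj z = -1) ↔ (z = 1 ∨ z = -1) := by
  have h (w : ℂ) : conj z = w ↔ z = conj w := by
    rw [← Complex.conj_conj w, (starRingEnd ℂ).injective.eq_iff, Complex.conj_conj]
  rw [h, h]
  simp

/-- Injectivity of `essH Γ` rules out an atom at `0`, so the condition on `Ψ` needs no restriction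
to `s > 0`. -/
lemma IsSpectralDatum.ae_pos (D : IsSpectralDatum Γ ρ ρt Ψ Ψt) (hΓ : IsHankel Γ) :
    ∀ᵐ s ∂ρ, 0 < s := by
  obtain ⟨h0, -, U, -, hUA⟩ := D.model.exists_unitary
  have := D.model.1.1
  filter_upwards [h0, ae_ne_zero_of_injective hUA hΓ.essH_injective] with s h1 h2
  exact lt_of_le_of_ne h1 h2.symm

section

variable {U : Lp ℂ 2 ρ ≃ₗᵢ[ℂ] essSpace Γ}
  (hv : (U.symm (symbolEss Γ) : ℝ → ℂ) =ᵐ[ρ] fun _ => 1)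

include hv

lemma IsHankel.conjOn_eq_conjEss (hΓ : IsHankel Γ) (hs : IsSimple Γ) (hsa : IsSelfAdjoint Γ)
    (hA : ∀ x, conjOn U (antiSq (essH Γ) x) = antiSq (essH Γ) (conjOn U x)) :
    conjOn U = conjEss hΓ hsa :=
  conj_unique (hΓ.cyclic_essH hs) (conjOn_eq_self hv) (conjEss_symbolEss hΓ hsa) hA fun x => by
    rw [antiSq_apply, conjEss_essH, conjEss_essH, antiSq_apply]

lemma IsHankel.conjOn_eq_conjEss_trunc (hΓ : IsHankel Γ) (hs : IsSimple Γ)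
    (hsa : IsSelfAdjoint Γ)
    (hA : ∀ x, conjOn U (antiSq (essHTrunc Γ) x) = antiSq (essHTrunc Γ) (conjOn U x)) :
    conjOn U = conjEss hΓ hsa :=
  conj_unique (hΓ.cyclic_essHTrunc hs) (conjOn_eq_self hv) (conjEss_symbolEss hΓ hsa) hA fun x => by
    rw [antiSq_apply, conjEss_essHTrunc, conjEss_essHTrunc, antiSq_apply]

/-- The conjugation fixes the symbol and conjugates inner products, so it also commutes with the
rank-one term. -/
lemma IsHankel.conjOn_antiSq_essHTrunc (hΓ : IsHankel Γ)
    (hA : ∀ x, conjOn U (antiSq (essH Γ) x) = antiSq (essH Γ) (conjOn U x)) (x : essSpace Γ) :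
    conjOn U (antiSq (essHTrunc Γ) x) = antiSq (essHTrunc Γ) (conjOn U x) := by
  have h : ⟪symbolEss Γ, conjOn U x⟫_ℂ = conj ⟪symbolEss Γ, x⟫_ℂ := by
    conv_lhs => rw [← conjOn_eq_self hv]
    rw [inner_conjOn, inner_conj_symm]
  rw [hΓ.antiSq_essHTrunc, hΓ.antiSq_essHTrunc, map_sub, map_smulₛₗ, conjOn_eq_self hv, hA, h]

end

/-- A Hankel operator is self-adjoint if and only if its spectral functions take the values `±1`
only. -/
theorem IsSpectralDatum.isSelfAdjoint_iff (D : IsSpectralDatum Γ ρ ρt Ψ Ψt) (hΓ : IsHankel Γ)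
    (hs : IsSimple Γ) :
    IsSelfAdjoint Γ ↔ (∀ᵐ s ∂ρ, Ψ s = 1 ∨ Ψ s = -1) ∧
      (∀ᵐ s ∂(ρt.restrict (Set.Ioi 0)), Ψt s = 1 ∨ Ψt s = -1) := by
  obtain ⟨h0, -, U, hv, hUA⟩ := D.model.exists_unitary
  obtain ⟨h0t, -, Ut, hvt, hUAt⟩ := D.model_trunc.exists_unitary
  have hJA := conjOn_antiSq hUA h0 D.ae_norm
  have hJB := conjOn_antiSq hUAt h0t D.ae_norm_trunc
  have e1 : (∀ᵐ s ∂ρ, Ψ s = 1 ∨ Ψ s = -1) ↔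
      conjOn U (essH Γ (symbolEss Γ)) = essH Γ (symbolEss Γ) := by
    rw [conjOn_apply_eq_iff hUA h0 D.ae_norm hv]
    refine ⟨fun h => ?_, fun h => ?_⟩
    · filter_upwards [h] with s hs _ using conj_eq_one_or_neg_one.2 hs
    · filter_upwards [h, D.ae_pos hΓ] with s hs hp using conj_eq_one_or_neg_one.1 (hs hp)
  have e2 : (∀ᵐ s ∂(ρt.restrict (Set.Ioi 0)), Ψt s = 1 ∨ Ψt s = -1) ↔
      conjOn Ut (essHTrunc Γ (symbolEss Γ)) = essHTrunc Γ (symbolEss Γ) := by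
    rw [conjOn_apply_eq_iff hUAt h0t D.ae_norm_trunc hvt, ae_restrict_iff' measurableSet_Ioi]
    rfl
  rw [e1, e2]
  constructor
  · intro hsa
    rw [hΓ.conjOn_eq_conjEss hv hs hsa hJA, hΓ.conjOn_eq_conjEss_trunc hvt hs hsa hJB,
      conjEss_essH, conjEss_essHTrunc, conjEss_symbolEss]
    exact ⟨rfl, rfl⟩
  · rintro ⟨hA, hB⟩
    -- The two models, built on different measures, share one conjugation; this lets the two reality
    -- conditions be used together.
    have hJ : conjOn Ut = conjOn U :=
      conj_unique (hΓ.cyclic_essHTrunc hs) (conjOn_eq_self hvt) (conjOn_eq_self hv) hJB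
        (hΓ.conjOn_antiSq_essHTrunc hv hJA)
    refine hΓ.isSelfAdjoint_of_conj (conjOn_conjOn U) (inner_conjOn U) (conjOn_eq_self hv)
      (apply_comm_of_conj (hΓ.cyclic_essH hs) (conjOn_eq_self hv) hJA hA) ?_
    rw [hJ] at hB hJB
    exact apply_comm_of_conj (hΓ.cyclic_essHTrunc hs) (conjOn_eq_self hv) hJB hB

end SpectralDatum

/-! ### Polar decomposition of transplanted multiplication operators. -/

section PolarDecomposition

variable {X : Type*} [NormedAddCommGroup X] [InnerProductSpace ℂ X] [CompleteSpace X]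

/-- A self-adjoint `Φ` with `Φ³ = Φ` is a partial isometry with initial and final space `(ker Φ)ᗮ`.
Equality of the kernels identifies this space with the closure of the range of `T = T*`. -/
lemma isPolarDecomposition_of_isSelfAdjoint {T Φ : X →L[ℂ] X} (hT : IsSelfAdjoint T)
    (hΦ : IsSelfAdjoint Φ) (hTΦ : T = Φ.comp (absOp T)) (hΦ3 : ∀ x, Φ (Φ (Φ x)) = Φ x)
    (hker : ∀ x, T x = 0 ↔ Φ x = 0) : IsPolarDecomposition T Φ := by
  rw [ContinuousLinearMap.isSelfAdjoint_iff'] at hT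
  have hΦs := ContinuousLinearMap.isSelfAdjoint_iff_isSymmetric.1 hΦ
  have hker' : LinearMap.ker (T : X →ₗ[ℂ] X) = LinearMap.ker (Φ : X →ₗ[ℂ] X) := by
    ext x
    exact hker x
  have hcl : (LinearMap.range (T : X →ₗ[ℂ] X)).topologicalClosure
      = (LinearMap.ker (Φ : X →ₗ[ℂ] X))ᗮ := by
    rw [← hker', T.orthogonal_ker, hT]
  have hmem : ∀ x, Φ x ∈ (LinearMap.ker (Φ : X →ₗ[ℂ] X))ᗮ := by
    intro x
    rw [Submodule.mem_orthogonal]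
    intro y hy
    have hy' : Φ y = 0 := hy
    have h : ⟪Φ y, x⟫_ℂ = ⟪y, Φ x⟫_ℂ := hΦs y x
    rw [← h, hy', inner_zero_left]
  have hsq : ∀ x ∈ (LinearMap.ker (Φ : X →ₗ[ℂ] X))ᗮ, Φ (Φ x) = x := by
    intro x hx
    have h1 : Φ (Φ x) - x ∈ (LinearMap.ker (Φ : X →ₗ[ℂ] X))ᗮ := Submodule.sub_mem _ (hmem _) hx
    have h2 : Φ (Φ x) - x ∈ LinearMap.ker (Φ : X →ₗ[ℂ] X) := by
      change Φ (Φ (Φ x) - x) = 0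
      rw [map_sub, hΦ3, sub_self]
    rw [← sub_eq_zero, ← inner_self_eq_zero (𝕜 := ℂ)]
    exact (Submodule.mem_orthogonal _ _).1 h1 _ h2
  refine ⟨hTΦ, ?_, ?_, ?_⟩
  · intro x hx
    rw [hT, hcl] at hx
    have h : ⟪Φ (Φ x), x⟫_ℂ = ⟪Φ x, Φ x⟫_ℂ := hΦs (Φ x) x
    rw [hsq x hx, inner_self_eq_norm_sq_to_K, inner_self_eq_norm_sq_to_K] at h
    have h' : ‖x‖ ^ 2 = ‖Φ x‖ ^ 2 := by exact_mod_cast h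
    exact ((sq_eq_sq₀ (norm_nonneg _) (norm_nonneg _)).1 h').symm
  · intro x hx
    rw [hT, hcl, Submodule.orthogonal_orthogonal_eq_closure] at hx
    have : IsClosed (LinearMap.ker (Φ : X →ₗ[ℂ] X) : Set X) := Φ.isClosed_ker
    rw [this.submodule_topologicalClosure_eq] at hx
    exact hx
  · rw [hcl]
    refine le_antisymm ?_ fun x hx => ⟨Φ x, hsq x hx⟩
    rintro _ ⟨x, rfl⟩
    exact hmem x

variable {ρ : Measure ℝ} (W : Lp ℂ 2 ρ →ₗᵢ[ℂ] X)

/-- The adjoint of an isometry of `L²(ρ)` into `X`. -/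
def isoAdj : X →L[ℂ] Lp ℂ 2 ρ := W.toContinuousLinearMap.adjoint

lemma inner_isoAdj (f : Lp ℂ 2 ρ) (x : X) : ⟪f, isoAdj W x⟫_ℂ = ⟪W f, x⟫_ℂ :=
  W.toContinuousLinearMap.adjoint_inner_right f x

lemma isoAdj_inner (f : Lp ℂ 2 ρ) (x : X) : ⟪isoAdj W x, f⟫_ℂ = ⟪x, W f⟫_ℂ :=
  W.toContinuousLinearMap.adjoint_inner_left f x

lemma isoAdj_apply (f : Lp ℂ 2 ρ) : isoAdj W (W f) = f :=
  congrArg (fun F => F f) W.adjoint_comp_self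

/-- The transplantation of a multiplication operator to `X` along an isometry. -/
def transOp (g : ℝ → ℂ) (hg : MemLp g ∞ ρ) : X →L[ℂ] X :=
  (W.toContinuousLinearMap.comp (mulOp g hg)).comp (isoAdj W)

lemma transOp_apply (g : ℝ → ℂ) (hg : MemLp g ∞ ρ) (x : X) :
    transOp W g hg x = W (mulOp g hg (isoAdj W x)) := rfl

variable {W}

lemma transOp_transOp {g h k : ℝ → ℂ} (hg : MemLp g ∞ ρ) (hh : MemLp h ∞ ρ) (hk : MemLp k ∞ ρ)
    (e : ∀ᵐ s ∂ρ, g s * h s = k s) (x : X) :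
    transOp W g hg (transOp W h hh x) = transOp W k hk x := by
  rw [transOp_apply, transOp_apply, transOp_apply, isoAdj_apply]
  congr 1
  apply Lp.ext
  filter_upwards [coeFn_mulOp g hg (mulOp h hh (isoAdj W x)), coeFn_mulOp h hh (isoAdj W x),
    coeFn_mulOp k hk (isoAdj W x), e] with s h1 h2 h3 h4
  rw [h1, h2, h3, ← h4, mul_assoc]

lemma isSelfAdjoint_transOp {g : ℝ → ℂ} (hg : MemLp g ∞ ρ) (e : ∀ᵐ s ∂ρ, conj (g s) = g s) :
    IsSelfAdjoint (transOp W g hg) := by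
  rw [ContinuousLinearMap.isSelfAdjoint_iff_isSymmetric]
  intro x y
  change ⟪transOp W g hg x, y⟫_ℂ = ⟪x, transOp W g hg y⟫_ℂ
  rw [transOp_apply, transOp_apply, ← inner_isoAdj, ← isoAdj_inner, L2.inner_def, L2.inner_def]
  refine integral_congr_ae ?_
  filter_upwards [coeFn_mulOp g hg (isoAdj W x), coeFn_mulOp g hg (isoAdj W y), e] with s h1 h2 h3
  rw [h1, h2]
  simp only [RCLike.inner_apply, map_mul, h3]
  ring

lemma transOp_eq_zero_iff {g : ℝ → ℂ} (hg : MemLp g ∞ ρ) (x : X) :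
    transOp W g hg x = 0 ↔ ∀ᵐ s ∂ρ, g s = 0 ∨ (isoAdj W x : ℝ → ℂ) s = 0 := by
  rw [transOp_apply, map_eq_zero_iff W W.injective, Lp.eq_zero_iff_ae_eq_zero]
  constructor
  · intro h
    filter_upwards [h, coeFn_mulOp g hg (isoAdj W x)] with s h1 h2
    rw [h1] at h2
    exact mul_eq_zero.1 h2.symm
  · intro h
    filter_upwards [h, coeFn_mulOp g hg (isoAdj W x)] with s h1 h2
    rw [h2]
    exact mul_eq_zero.2 h1

lemma inner_transOp {g : ℝ → ℂ} (hg : MemLp g ∞ ρ) (x : X) :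
    ⟪x, transOp W g hg x⟫_ℂ = ∫ s, ((‖(isoAdj W x : ℝ → ℂ) s‖ ^ 2 : ℝ) : ℂ) * g s ∂ρ := by
  rw [transOp_apply, ← isoAdj_inner, L2.inner_def]
  refine integral_congr_ae ?_
  filter_upwards [coeFn_mulOp g hg (isoAdj W x)] with s h1
  rw [h1, RCLike.inner_apply, mul_assoc, Complex.mul_conj, Complex.normSq_eq_norm_sq, mul_comm]

variable (W) in
/-- The measure `|W* x|² ρ + ‖x - W W* x‖² δ₀`. -/
def transMeasure (x : X) : Measure ℝ :=
  ρ.withDensity (fun s => ENNReal.ofReal (‖(isoAdj W x : ℝ → ℂ) s‖ ^ 2))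
    + ENNReal.ofReal (‖x - W (isoAdj W x)‖ ^ 2) • Measure.dirac 0

lemma integrable_norm_sq (f : Lp ℂ 2 ρ) : Integrable (fun s => ‖(f : ℝ → ℂ) s‖ ^ 2) ρ :=
  (Lp.memLp f).integrable_norm_pow (by norm_num)

lemma isFiniteMeasure_withDensity_norm_sq (f : Lp ℂ 2 ρ) :
    IsFiniteMeasure (ρ.withDensity fun s => ENNReal.ofReal (‖(f : ℝ → ℂ) s‖ ^ 2)) :=
  isFiniteMeasure_withDensity_ofReal (integrable_norm_sq f).2

instance isFiniteMeasure_transMeasure (x : X) : IsFiniteMeasure (transMeasure W x) := by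
  have := isFiniteMeasure_withDensity_norm_sq (isoAdj W x)
  have := Measure.smul_finite (Measure.dirac (0 : ℝ))
    (c := ENNReal.ofReal (‖x - W (isoAdj W x)‖ ^ 2)) ENNReal.ofReal_ne_top
  unfold transMeasure
  infer_instance

lemma ae_transMeasure {p : ℝ → Prop} (hp : ∀ᵐ s ∂ρ, p s) (h0 : p 0) (x : X) :
    ∀ᵐ s ∂(transMeasure W x), p s := by
  rw [transMeasure, ae_add_measure_iff]
  refine ⟨(withDensity_absolutelyContinuous _ _).ae_le hp, ?_⟩
  refine Measure.ae_smul_measure ?_ _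
  rw [ae_dirac_eq]
  exact h0

lemma integral_transMeasure {E : Type*} [NormedAddCommGroup E] [NormedSpace ℝ E] [CompleteSpace E]
    {g : ℝ → E} {x : X} (hg : Integrable g (transMeasure W x)) :
    ∫ s, g s ∂(transMeasure W x)
      = ∫ s, ‖(isoAdj W x : ℝ → ℂ) s‖ ^ 2 • g s ∂ρ + ‖x - W (isoAdj W x)‖ ^ 2 • g 0 := by
  have hm : Measurable fun s => ENNReal.ofReal (‖(isoAdj W x : ℝ → ℂ) s‖ ^ 2) := by
    have := (Lp.stronglyMeasurable (isoAdj W x)).measurable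
    fun_prop
  rw [transMeasure] at hg ⊢
  rw [integral_add_measure hg.left_of_add_measure hg.right_of_add_measure, integral_smul_measure,
    integral_dirac, ENNReal.toReal_ofReal (by positivity),
    integral_withDensity_eq_integral_toReal_smul hm (ae_of_all _ fun s => ENNReal.ofReal_lt_top)]
  congr 1
  refine integral_congr_ae (ae_of_all _ fun s => ?_)
  simp only [ENNReal.toReal_ofReal (sq_nonneg _)]

lemma isoAdj_sub (x : X) : isoAdj W (x - W (isoAdj W x)) = 0 := by
  rw [map_sub, isoAdj_apply, sub_self]

lemma inner_sub_isoAdj (x : X) :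
    ⟪x, x - W (isoAdj W x)⟫_ℂ = ((‖x - W (isoAdj W x)‖ ^ 2 : ℝ) : ℂ) := by
  have h1 : ⟪W (isoAdj W x), x - W (isoAdj W x)⟫_ℂ = 0 := by
    rw [← inner_isoAdj, isoAdj_sub, inner_zero_right]
  have h2 : ⟪x - W (isoAdj W x), x - W (isoAdj W x)⟫_ℂ = ⟪x, x - W (isoAdj W x)⟫_ℂ := by
    rw [inner_sub_left, h1, sub_zero]
  rw [← h2, inner_self_eq_norm_sq_to_K]
  norm_cast

/-- The moments suffice. The part of `x` off the range of `W` is killed by the operator, so it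
contributes mass at `0`. -/
lemma isSpectralMeasure_transMeasure [IsFiniteMeasure ρ] {B : ℝ} (hB : ∀ᵐ s ∂ρ, |s| ≤ B)
    (hid : MemLp (fun s : ℝ => (s : ℂ)) ∞ ρ) (x : X) :
    IsSpectralMeasure (transOp W _ hid) x (transMeasure W x) := by
  have hB0 : ∀ᵐ s ∂(transMeasure W x), |s| ≤ |B| :=
    ae_transMeasure (hB.mono fun s hs => hs.trans (le_abs_self B)) (by simp) x
  refine isSpectralMeasure_of_moments
    (isSelfAdjoint_transOp hid (ae_of_all _ fun s => Complex.conj_ofReal s)) hB0 fun n => ?_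
  have hpow : MemLp (fun s : ℝ => (s : ℂ) ^ n) ∞ ρ :=
    memLp_of_continuous_of_ae_abs_le hB (by fun_prop) _
  -- The convention `0 ^ 0 = 1` keeps the orthogonal part of `x` in the zeroth power only.
  have hn : (transOp W _ hid ^ n) x
      = transOp W _ hpow x + (0 : ℂ) ^ n • (x - W (isoAdj W x)) := by
    clear hB0
    induction n with
    | zero =>
      have : mulOp _ hpow (isoAdj W x) = isoAdj W x := by
        apply Lp.ext
        filter_upwards [coeFn_mulOp _ hpow (isoAdj W x)] with s hs
        rw [hs, pow_zero, one_mul]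
      rw [transOp_apply, this, pow_zero, pow_zero, one_smul, one_apply_eq_self]
      abel
    | succ n ih =>
      have hpow' : MemLp (fun s : ℝ => (s : ℂ) ^ n) ∞ ρ :=
        memLp_of_continuous_of_ae_abs_le hB (by fun_prop) _
      have h0 : transOp W _ hid (x - W (isoAdj W x)) = 0 := by
        rw [transOp_apply, isoAdj_sub, map_zero, map_zero]
      rw [pow_succ', mul_apply_eq_comp, ih hpow', map_add, map_smul, h0,
        transOp_transOp hid hpow' hpow (ae_of_all _ fun s => (pow_succ' _ _).symm)]
      simp
  rw [hn, inner_add_right, inner_smul_right, inner_transOp, inner_sub_isoAdj,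
    integral_transMeasure (integrable_of_continuous_of_ae_abs_le hB0 (by fun_prop)),
    Complex.ofReal_add, ← integral_complex_ofReal]
  simp only [smul_eq_mul]
  push_cast
  ring

/-- The polar decomposition of a self-adjoint operator which is given on the range of an isometry
by multiplication by the function `s θ(s)` and vanishes on the orthogonal complement. -/
theorem exists_polarDecomposition [IsFiniteMeasure ρ] {B : ℝ} (hB : ∀ᵐ s ∂ρ, |s| ≤ B)
    (h0 : ∀ᵐ s ∂ρ, 0 ≤ s) {θ : ℝ → ℂ} (hθm : Measurable θ)
    (hθ : ∀ᵐ s ∂ρ, 0 < s → θ s = 1 ∨ θ s = -1) {T : X →L[ℂ] X}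
    (hT : ∀ f : Lp ℂ 2 ρ, ∃ g : Lp ℂ 2 ρ, T (W f) = W g ∧
      (g : ℝ → ℂ) =ᵐ[ρ] fun s => (s : ℂ) * θ s * (f : ℝ → ℂ) s)
    (hT0 : ∀ x, isoAdj W x = 0 → T x = 0) :
    ∃ Φ : X →L[ℂ] X, IsBorelFunctionOf (absOp T) (zeroOnKer T θ) Φ ∧ IsPolarDecomposition T Φ := by
  set η := zeroOnKer T θ with hη
  have hηθ : ∀ s, s ≠ 0 → η s = θ s := by
    intro s hs
    rw [hη, zeroOnKer]
    split_ifs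
    · rfl
    · rw [Function.update_of_ne hs]
  have hηm : Measurable η := by
    rw [hη, zeroOnKer]
    split_ifs
    · exact hθm
    · have : Function.update θ 0 0 = fun s => if s = 0 then 0 else θ s := by
        funext s
        exact Function.update_apply θ 0 0 s
      rw [this]
      exact Measurable.ite (measurableSet_singleton (0 : ℝ)) measurable_const hθm
  -- If the kernel is trivial, `ρ` has no atom at `0`, since `T` kills the image of the indicator of
  -- `{0}`; otherwise `η 0 = 0` by definition.
  have hη0 : ∀ᵐ s ∂ρ, s = 0 → η s = 0 := by
    by_cases hk : LinearMap.ker (T : X →ₗ[ℂ] X) = ⊥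
    · set f : Lp ℂ 2 ρ := indicatorConstLp 2 (measurableSet_singleton (0 : ℝ))
        (measure_ne_top ρ _) (1 : ℂ)
      have hf : (f : ℝ → ℂ) =ᵐ[ρ] _ := indicatorConstLp_coeFn
      obtain ⟨g, hg1, hg2⟩ := hT f
      have hg : g = 0 := by
        rw [Lp.eq_zero_iff_ae_eq_zero]
        filter_upwards [hg2, hf] with s h1 h2
        rw [h1, h2]
        by_cases h : s = 0 <;> simp [h]
      have hf0 : W f = 0 := by
        have : W f ∈ LinearMap.ker (T : X →ₗ[ℂ] X) := by
          change T (W f) = 0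
          rw [hg1, hg, map_zero]
        rwa [hk, Submodule.mem_bot] at this
      rw [map_eq_zero_iff W W.injective] at hf0
      rw [hf0] at hf
      filter_upwards [hf, Lp.coeFn_zero ℂ 2 ρ] with s h1 h2 h3
      rw [h2] at h1
      simp [h3] at h1
    · refine ae_of_all _ fun s hs => ?_
      rw [hη, zeroOnKer, if_neg hk, hs, Function.update_self]
  have hcases : ∀ᵐ s ∂ρ, (s = 0 ∧ η s = 0) ∨ (0 < s ∧ (η s = 1 ∨ η s = -1)) := by
    filter_upwards [hη0, hθ, h0] with s h1 h2 h3
    rcases h3.eq_or_lt with h | h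
    · exact Or.inl ⟨h.symm, h1 h.symm⟩
    · rw [hηθ s h.ne']
      exact Or.inr ⟨h, h2 h⟩
  have hηb : ∀ᵐ s ∂ρ, ‖η s‖ ≤ 1 := by
    filter_upwards [hcases] with s hs
    rcases hs with ⟨-, h⟩ | ⟨-, h | h⟩ <;> simp [h]
  have mη : MemLp η ∞ ρ := MemLp.of_bound hηm.aestronglyMeasurable 1 hηb
  have mid : MemLp (fun s : ℝ => (s : ℂ)) ∞ ρ :=
    memLp_of_continuous_of_ae_abs_le hB (by fun_prop) _
  have msq : MemLp (fun s : ℝ => (s : ℂ) ^ 2) ∞ ρ :=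
    memLp_of_continuous_of_ae_abs_le hB (by fun_prop) _
  have mrt : MemLp (fun s : ℝ => ((√s : ℝ) : ℂ)) ∞ ρ :=
    memLp_of_continuous_of_ae_abs_le hB (by fun_prop) _
  have mT : MemLp (fun s : ℝ => (s : ℂ) * η s) ∞ ρ := by
    refine MemLp.of_bound (by fun_prop) (1 * |B|) ?_
    filter_upwards [hηb, hB] with s h1 h2
    rw [norm_mul, mul_comm, Complex.norm_real, Real.norm_eq_abs]
    exact mul_le_mul h1 (h2.trans (le_abs_self B)) (abs_nonneg _) zero_le_one
  have hTeq : T = transOp W _ mT := by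
    ext1 x
    obtain ⟨g, hg1, hg2⟩ := hT (isoAdj W x)
    have h1 : T x = T (W (isoAdj W x)) := by
      rw [← sub_eq_zero, ← map_sub]
      exact hT0 _ (isoAdj_sub x)
    rw [h1, hg1, transOp_apply]
    congr 1
    apply Lp.ext
    filter_upwards [hg2, coeFn_mulOp _ mT (isoAdj W x)] with s h2 h3
    rw [h2, h3]
    by_cases hs : s = 0
    · simp [hs]
    · rw [hηθ s hs]
  have hηreal : ∀ᵐ s ∂ρ, conj (η s) = η s := by
    filter_upwards [hcases] with s hs
    rcases hs with ⟨-, h⟩ | ⟨-, h | h⟩ <;> simp [h]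
  have hTsa : IsSelfAdjoint T := by
    rw [hTeq]
    refine isSelfAdjoint_transOp mT ?_
    filter_upwards [hηreal] with s hs
    rw [map_mul, hs, Complex.conj_ofReal]
  have habs : absOp T = transOp W _ mid := by
    -- Multiplication by `s ≥ 0` is the square of multiplication by `√s`.
    have hpos : 0 ≤ transOp W _ mid := by
      have hrt := isSelfAdjoint_transOp (W := W) mrt (ae_of_all _ fun s => Complex.conj_ofReal _)
      have : transOp W _ mid = star (transOp W _ mrt) * transOp W _ mrt := by
        rw [hrt.star_eq]
        ext1 x
        rw [mul_apply_eq_comp, transOp_transOp mrt mrt mid]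
        filter_upwards [h0] with s hs
        rw [← Complex.ofReal_mul, Real.mul_self_sqrt hs]
      rw [this]
      exact star_mul_self_nonneg _
    refine CFC.sqrt_unique ?_ hpos
    rw [hTsa.star_eq]
    ext1 x
    rw [mul_apply_eq_comp, mul_apply_eq_comp, hTeq, transOp_transOp mid mid msq,
      transOp_transOp mT mT msq]
    · filter_upwards [hcases] with s hs
      rcases hs with ⟨h, h'⟩ | ⟨-, h | h⟩ <;> simp [h] <;> ring
    · exact ae_of_all _ fun s => (pow_two _).symm
  have hker : ∀ x, T x = 0 ↔ transOp W η mη x = 0 := by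
    intro x
    rw [hTeq, transOp_eq_zero_iff, transOp_eq_zero_iff]
    refine Filter.eventually_congr ?_
    filter_upwards [hcases] with s hs
    rcases hs with ⟨h, h'⟩ | ⟨hp, h | h⟩
    · subst h
      simp [h']
    · simp [h, hp.ne']
    · simp [h, hp.ne']
  refine ⟨transOp W η mη, ?_, isPolarDecomposition_of_isSelfAdjoint hTsa
    (isSelfAdjoint_transOp mη hηreal) ?_ ?_ hker⟩
  · intro x
    have hint : Integrable η (transMeasure W x) := by
      -- The bound includes `‖η 0‖` because the measure may have an atom at `0` that `ρ` lacks.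
      refine Integrable.of_bound hηm.aestronglyMeasurable (max 1 ‖η 0‖) ?_
      exact ae_transMeasure (p := fun s => ‖η s‖ ≤ max 1 ‖η 0‖)
        (hηb.mono fun s hs => hs.trans (le_max_left _ _)) (le_max_right _ _) x
    refine ⟨transMeasure W x, ?_, hint, ?_⟩
    · rw [habs]
      exact isSpectralMeasure_transMeasure hB mid x
    -- The orthogonal part of `x` lies in the kernel of `T`: either the kernel is trivial and this
    -- part is zero, or `η 0 = 0`.
    · have hz : ‖x - W (isoAdj W x)‖ ^ 2 • η 0 = 0 := by
        by_cases hk : LinearMap.ker (T : X →ₗ[ℂ] X) = ⊥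
        · have : x - W (isoAdj W x) ∈ LinearMap.ker (T : X →ₗ[ℂ] X) := hT0 _ (isoAdj_sub x)
          rw [hk, Submodule.mem_bot] at this
          simp [this]
        · rw [hη, zeroOnKer, if_neg hk, Function.update_self, smul_zero]
      rw [integral_transMeasure hint, hz, add_zero, inner_transOp]
      simp only [Complex.real_smul]
  · rw [habs]
    ext1 x
    change T x = transOp W η mη (transOp W _ mid x)
    rw [hTeq, transOp_transOp mη mid mT (ae_of_all _ fun s => mul_comm _ _)]
  · intro x
    have mηη : MemLp (fun s => η s * η s) ∞ ρ := by
      refine MemLp.of_bound (by fun_prop) 1 ?_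
      filter_upwards [hηb] with s hs
      rw [norm_mul]
      exact mul_le_one₀ hs (norm_nonneg _) hs
    rw [transOp_transOp mη mη mηη (ae_of_all _ fun s => rfl), transOp_transOp mηη mη mη]
    filter_upwards [hcases] with s hs
    rcases hs with ⟨-, h⟩ | ⟨-, h | h⟩ <;> simp [h]

end PolarDecomposition

/-! ### Self-adjoint Hankel operators in the model. -/

section SelfAdjointHankel

variable {Γ : H2 →L[ℂ] H2} {ρ : Measure ℝ} (U : Lp ℂ 2 ρ ≃ₗᵢ[ℂ] essSpace Γ)

/-- A unitary operator onto the closure of the range of `H_u` as an isometry into the Hardy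
space. -/
def essIso : Lp ℂ 2 ρ →ₗᵢ[ℂ] H2 := (essSpace Γ).subtypeₗᵢ.comp U.toLinearIsometry

lemma essIso_apply (f : Lp ℂ 2 ρ) : essIso U f = (U f : H2) := rfl

lemma mem_orthogonal_of_isoAdj_eq_zero {x : H2} (hx : isoAdj (essIso U) x = 0) :
    x ∈ (essSpace Γ)ᗮ := by
  rw [Submodule.mem_orthogonal]
  intro y hy
  have h := inner_isoAdj (essIso U) (U.symm ⟨y, hy⟩) x
  rw [hx, inner_zero_right, essIso_apply, LinearIsometryEquiv.apply_symm_apply] at h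
  exact h.symm

/-- Self-adjointness gives `Γ = C Γ C = C H_u`, and `H_u` vanishes on this complement. -/
lemma IsHankel.apply_eq_zero (hΓ : IsHankel Γ) (hsa : IsSelfAdjoint Γ) {x : H2}
    (hx : x ∈ (essSpace Γ)ᗮ) : Γ x = 0 := by
  rw [← conjH_conjH (Γ x), hΓ.conjH_apply hsa, ← antiH_apply, hΓ.antiH_eq_zero hx, map_zero]

lemma IsHankel.trunc_apply_eq_zero (hΓ : IsHankel Γ) (hsa : IsSelfAdjoint Γ) {x : H2}
    (hx : x ∈ (essSpace Γ)ᗮ) : trunc Γ x = 0 := by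
  rw [← conjH_conjH x, ← antiH_apply, ← antiHTrunc_eq]
  refine eq_zero_of_inner_zpw fun n => ?_
  rw [hΓ.inner_zpw_antiHTrunc, antiH_apply, conjH_conjH, hΓ.apply_eq_zero hsa hx, inner_zero_right]

variable {U}

/-- The conjugation in the model of `A` cancels against `J`, leaving a linear multiplication. -/
lemma exists_model_apply {T : H2 →L[ℂ] H2} {A J : essSpace Γ →L⋆[ℂ] essSpace Γ}
    (hTA : ∀ x : essSpace Γ, T x = (A (J x) : H2)) {ψ θ : ℝ → ℂ}
    (hUA : ∀ f : Lp ℂ 2 ρ, (U.symm (A (U f)) : ℝ → ℂ) =ᵐ[ρ]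
      fun s => (s : ℂ) * ψ s * conj ((f : ℝ → ℂ) s))
    (hJ : conjOn U = J) (hψθ : ∀ᵐ s : ℝ ∂ρ, (s : ℂ) * ψ s = s * θ s) (f : Lp ℂ 2 ρ) :
    ∃ g : Lp ℂ 2 ρ, T (essIso U f) = essIso U g ∧
      (g : ℝ → ℂ) =ᵐ[ρ] fun s => (s : ℂ) * θ s * (f : ℝ → ℂ) s := by
  refine ⟨U.symm (A (U (conjLp ρ f))), ?_, ?_⟩
  · rw [essIso_apply, essIso_apply, LinearIsometryEquiv.apply_symm_apply, hTA, ← hJ, conjOn_apply,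
      LinearIsometryEquiv.symm_apply_apply]
  · filter_upwards [hUA (conjLp ρ f), coeFn_conjLp f, hψθ] with s h1 h2 h3
    rw [h1, h2, h3, Complex.conj_conj]

end SelfAdjointHankel

/-! ### The two polar decompositions. -/

section Main

variable {Γ : H2 →L[ℂ] H2} {ρ ρt : Measure ℝ} {Ψ Ψt : ℝ → ℂ}

/-- The polar decomposition of a self-adjoint Hankel operator. -/
theorem IsSpectralDatum.exists_polarDecomposition (D : IsSpectralDatum Γ ρ ρt Ψ Ψt)
    (hΓ : IsHankel Γ) (hs : IsSimple Γ) (hsa : IsSelfAdjoint Γ) :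
    ∃ Φ : H2 →L[ℂ] H2, IsBorelFunctionOf (absOp Γ) (zeroOnKer Γ Ψ) Φ ∧
      IsPolarDecomposition Γ Φ := by
  obtain ⟨h0, ⟨B, hB⟩, U, hv, hUA⟩ := D.model.exists_unitary
  have := D.model.1.1
  have hJ := hΓ.conjOn_eq_conjEss hv hs hsa (conjOn_antiSq hUA h0 D.ae_norm)
  have hΨ := ((D.isSelfAdjoint_iff hΓ hs).1 hsa).1
  refine HankelSpec.exists_polarDecomposition (W := essIso U) hB h0 D.measurable
    (hΨ.mono fun s h _ => h) (exists_model_apply (fun x => ?_) hUA hJ ?_)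
    fun x hx => hΓ.apply_eq_zero hsa (mem_orthogonal_of_isoAdj_eq_zero U hx)
  · rw [coe_essH, coe_conjEss, antiH_apply, conjH_conjH]
  -- The model of `essH Γ` carries the conjugate of `Ψ`, which equals `Ψ` because the values are
  -- `±1`.
  · filter_upwards [hΨ] with s h
    rcases h with h | h <;> simp [h]

/-- The polar decomposition of a truncated self-adjoint Hankel operator. -/
theorem IsSpectralDatum.exists_polarDecomposition_trunc (D : IsSpectralDatum Γ ρ ρt Ψ Ψt)
    (hΓ : IsHankel Γ) (hs : IsSimple Γ) (hsa : IsSelfAdjoint Γ) :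
    ∃ Φ : H2 →L[ℂ] H2, IsBorelFunctionOf (absOp (trunc Γ)) (zeroOnKer (trunc Γ) Ψt) Φ ∧
      IsPolarDecomposition (trunc Γ) Φ := by
  obtain ⟨h0, ⟨B, hB⟩, U, hv, hUA⟩ := D.model_trunc.exists_unitary
  have := D.model_trunc.1.1
  have hJ := hΓ.conjOn_eq_conjEss_trunc hv hs hsa (conjOn_antiSq hUA h0 D.ae_norm_trunc)
  have hΨ := (ae_restrict_iff' measurableSet_Ioi).1 ((D.isSelfAdjoint_iff hΓ hs).1 hsa).2
  refine HankelSpec.exists_polarDecomposition (W := essIso U) hB h0 D.measurable_trunc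
    hΨ (exists_model_apply (fun x => ?_) hUA hJ (ae_of_all _ fun s => rfl))
    fun x hx => hΓ.trunc_apply_eq_zero hsa (mem_orthogonal_of_isoAdj_eq_zero U hx)
  rw [coe_essHTrunc, coe_conjEss, antiHTrunc_eq, antiH_apply, conjH_conjH]

end Main

end HankelSpec

end

theorem mainTheorem12 (Γ : H2 →L[ℂ] H2) (hΓ : IsHankel Γ) (hsimple : IsSimple Γ) :
    (∃ (ρ ρt : MeasureTheory.Measure ℝ) (Ψ Ψt : ℝ → ℂ), IsSpectralDatum Γ ρ ρt Ψ Ψt) ∧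
    ∀ (ρ ρt : MeasureTheory.Measure ℝ) (Ψ Ψt : ℝ → ℂ), IsSpectralDatum Γ ρ ρt Ψ Ψt →
      (IsSelfAdjoint Γ ↔
        (∀ᵐ s ∂ρ, Ψ s = 1 ∨ Ψ s = -1) ∧
        (∀ᵐ s ∂(ρt.restrict (Set.Ioi 0)), Ψt s = 1 ∨ Ψt s = -1)) ∧
      (IsSelfAdjoint Γ →
        (∃ Φ : H2 →L[ℂ] H2, IsBorelFunctionOf (absOp Γ) (zeroOnKer Γ Ψ) Φ ∧
          IsPolarDecomposition Γ Φ) ∧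
        (∃ Φt : H2 →L[ℂ] H2, IsBorelFunctionOf (absOp (trunc Γ)) (zeroOnKer (trunc Γ) Ψt) Φt ∧
          IsPolarDecomposition (trunc Γ) Φt)) := by
  refine ⟨hΓ.exists_isSpectralDatum hsimple, fun ρ ρt Ψ Ψt D =>
    ⟨D.isSelfAdjoint_iff hΓ hsimple, fun hsa => ⟨D.exists_polarDecomposition hΓ hsimple hsa,
      D.exists_polarDecomposition_trunc hΓ hsimple hsa⟩⟩⟩
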